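/- Let $\mathcal L_0$, $\mathcal L$ be Gorini–Kossakowski–Sudarshan–Lindblad (GKSL) generators on the complex $n\times n$ matrices, let $\mathcal P=\mathcal P^2$ be a superoperator (a linear map on these matrices), $\mathcal Q=I-\mathcal P$, and put $\mathcal L(t)=e^{-\mathcal L_0t}\mathcal L e^{\mathcal L_0t}$. Put $$\mathcal M_k(t)=\int_0^t dt_1\cdots\int_0^{t_{k-1}}dt_k\,\mathcal P\mathcal L(t_1)\cdots\mathcal L(t_k)\mathcal P,\qquad \tilde{\mathcal M}_k(t)=\int_0^t dt_1\cdots\int_0^{t_{k-1}}dt_k\,\mathcal P\mathcal L(t_1)\cdots\mathcal L(t_k)\mathcal Q,$$ $$\mathcal K_m(t)=\sum_{q=0}^{m-1}(-1)^q\sum_{k_0+\dots+k_q=m,\;k_j\ge1}\dot{\mathcal M}_{k_0}(t)\mathcal M_{k_1}(t)\cdots\mathcal M_{k_q}(t),$$ and let $\mathcal I_m(t)$ be given by the same sum with the last factor $\mathcal M_{k_q}$ (respectively $\dot{\mathcal M}_{k_0}$ if $q=0$) of each term replaced by $\tilde{\mathcal M}_{k_q}$ (respectively $\dot{\tilde{\mathcal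 M}}_{k_0}$). Write $\mathcal K_m(+\infty)$, $\mathcal I_m(+\infty)$ for their limits as $t\to+\infty$. Assume the enhanced relaxation conditions of every order: the limit $\Lambda=\lim_{t\to+\infty}e^{\mathcal L_0t}$ exists and, for every $k\ge1$, all $0\le t_1\le\dots\le t_k$ and both $\mathcal X=\mathcal P$ and $\mathcal X=\mathcal Q$, $$\mathcal P e^{-\mathcal L_0t_k}\mathcal L e^{\mathcal L_0(t_k-t_{k-1})}\cdots e^{\mathcal L_0(t_2-t_1)}\mathcal L e^{\mathcal L_0t_1}\mathcal X=\mathcal P\mathcal L e^{\mathcal L_0(t_k-t_{k-1})}\cdots e^{\mathcal L_0(t_2-t_1)}\mathcal L e^{\mathcal L_0t_1}\mathcal X .$$ Assume also that the limits $\mathcal K_1(+\infty)$, $\mathcal I_1(+\infty)$, $\mathcal K_3(+\infty)$, $\mathcal I_3(+\infty)$ exist and are all $0$. Then: (1) the limits $\mathcal K_2(+\infty)$ and $\mathcal I_2(+\infty)$ exist. Whenever $\mathcal L=[\mathcal L_0,\mathcal X]+\mathcal Z$ with superoperators $\mathcal X,\mathcal Z$ such that $[\mathcal L_0,\mathcal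 Z]=0$ (in particular for every solution $\mathcal X$ of $[\mathcal L_0,\mathcal X]=\mathcal L$), $$\mathcal K_2(+\infty)=\mathcal P\mathcal L[\Lambda,\mathcal X]\mathcal P-\mathcal P\mathcal L\Lambda\mathcal P\mathcal X(I-\Lambda)\mathcal P,\qquad \mathcal I_2(+\infty)=\mathcal P\mathcal L[\Lambda,\mathcal X]\mathcal Q-\mathcal P\mathcal L\Lambda\mathcal P\mathcal X(I-\Lambda)\mathcal Q;$$ (2) there is exactly one pseudoinverse $\mathcal L_0^{(-1)}$ of $\mathcal L_0$, that is, one superoperator with $\mathcal L_0^{(-1)}\mathcal L_0=I-\Lambda$ and $\mathcal L_0^{(-1)}\Lambda=\Lambda\mathcal L_0^{(-1)}=0$; (3) for all $\rho_0$, $b>0$ and $\varepsilon>0$ there are $C$ and $\lambda_0>0$ such that for every real $\lambda$ with $0<|\lambda|<\lambda_0$ for which $\mathcal L_0+\lambda\mathcal L$ is a GKSL generator (this includes every $\lambda\in(0,\lambda_0)$), the solution of $\frac{d}{dt}\rho(t)=\lambda\mathcal L(t)\rho(t)$, $t\ge0$, $\rho(0)=\rho_0$, satisfies, for all $t$ with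 $|\lambda|^{-\varepsilon}\le t\le b\lambda^{-2}$, $$\Bigl\|\mathcal P\rho(t)-e^{\lambda^2\mathcal K_2(+\infty)t}\,\mathcal R\rho(0)-\frac{e^{\lambda^2\mathcal K_2(+\infty)t}-1}{\mathcal K_2(+\infty)}\,\mathcal I_2(+\infty)\mathcal Q\rho(0)\Bigr\|\le C\lambda^2,\qquad \mathcal R=\mathcal P\bigl(I+\lambda\mathcal L\mathcal L_0^{(-1)}(\Lambda-I)\bigr).$$ In particular the error is $O(\lambda^2)$ for $t=\tau\lambda^{-2}$, uniformly for $\tau$ in compact subsets of $(0,\infty)$. Here $\frac{e^{sA}-1}{A}$ denotes the value at $A$ of the entire function $z\mapsto\frac{e^{sz}-1}{z}$, that is $\int_0^s e^{uA}\,du$. -/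

import Mathlib

open Filter Topology

-- Matrices carry the `ℓ²` operator norm (all norms on this finite-dimensional space are
-- equivalent) and superoperators the operator norm induced by it.
open scoped Matrix.Norms.L2Operator

/-- Linear operators on a normed space `E`, multiplication being composition. -/
abbrev LinOp (E : Type*) [NormedAddCommGroup E] [NormedSpace ℂ E] : Type _ := E →L[ℂ] E

/-- Superoperators: linear maps from complex `n × n` matrices to themselves (linear maps on a
finite-dimensional space are automatically continuous). -/
abbrev SuperOp (n : Type*) [Fintype n] [DecidableEq n] : Type _ := LinOp (Matrix n n ℂ)

noncomputable section

namespace TCL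

/-- `G` is a Gorini-Kossakowski-Sudarshan-Lindblad generator:
`G ρ = -i [H, ρ] + ∑ⱼ (Vⱼ ρ Vⱼ† - ½ {Vⱼ† Vⱼ, ρ})` with `H` Hermitian. -/
def IsGKSL {n : Type*} [Fintype n] [DecidableEq n] (G : SuperOp n) : Prop :=
  ∃ (H : Matrix n n ℂ) (m : ℕ) (V : Fin m → Matrix n n ℂ), H.IsHermitian ∧
    ∀ ρ : Matrix n n ℂ, G ρ = (-Complex.I) • (H * ρ - ρ * H) +
      ∑ j, (V j * ρ * (V j).conjTranspose -
        (1 / 2 : ℂ) • ((V j).conjTranspose * V j * ρ + ρ * ((V j).conjTranspose * V j)))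

variable {E : Type*} [NormedAddCommGroup E] [NormedSpace ℂ E]

/-- The interaction-picture generator `𝓛(t) = e^{-𝓛₀ t} 𝓛 e^{𝓛₀ t}`. -/
def interaction (L₀ L : LinOp E) (t : ℝ) : LinOp E :=
  NormedSpace.exp ((-t) • L₀) * L * NormedSpace.exp (t • L₀)

/-- The iterated integral
`∫₀ᵗ dt₁ ∫₀^{t₁} dt₂ ⋯ ∫₀^{t_{k-1}} dt_k 𝓛(t₁) 𝓛(t₂) ⋯ 𝓛(t_k)`. -/
def dyson (L₀ L : LinOp E) : ℕ → ℝ → LinOp E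
  | 0 => fun _ => 1
  | k + 1 => fun t => ∫ s in (0 : ℝ)..t, interaction L₀ L s * dyson L₀ L k s

/-- `∫₀ᵗ dt₁ ⋯ ∫₀^{t_{k-1}} dt_k P 𝓛(t₁) ⋯ 𝓛(t_k) X`.
For `X = P` this is the moment `𝓜_k(t)`, for `X = Q = 1 - P` it is `𝓜̃_k(t)`. -/
def moment (L₀ L P X : LinOp E) (k : ℕ) (t : ℝ) : LinOp E :=
  P * dyson L₀ L k t * X

/-- The product `𝓜_{k₁}(t) ⋯ 𝓜_{k_q}(t)`, the last factor being the moment with `X` in place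
of its right-most `P`. -/
def momentProd (L₀ L P X : LinOp E) (t : ℝ) : List ℕ → LinOp E
  | [] => 1
  | [k] => moment L₀ L P X k t
  | k :: l => moment L₀ L P P k t * momentProd L₀ L P X t l

/-- The term `(-1)^q 𝓜̇_{k₀}(t) 𝓜_{k₁}(t) ⋯ 𝓜_{k_q}(t)` of the composition `k₀, …, k_q`, where
the last factor (`𝓜̇_{k₀}(t)` if `q = 0`) has `X` in place of its right-most `P`. -/
def tclTerm (L₀ L P X : LinOp E) (t : ℝ) : List ℕ → LinOp E
  | [] => 0
  | [k] => deriv (moment L₀ L P X k) t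
  | k :: l => (-1) ^ l.length * deriv (moment L₀ L P P k) t * momentProd L₀ L P X t l

/-- The sum over all compositions of `m`. -/
def tclCoeff (L₀ L P X : LinOp E) (m : ℕ) (t : ℝ) : LinOp E :=
  ∑ c : Composition m, tclTerm L₀ L P X t c.blocks

/-- The coefficient `𝓚_m(t)` of `λ^m` in the homogeneous part of the time-convolutionless
master equation `d/dt Pρ = 𝓚(t) Pρ(t) + 𝓘(t) Qρ(0)`. -/
def Kcoeff (L₀ L P : LinOp E) (m : ℕ) (t : ℝ) : LinOp E := tclCoeff L₀ L P P m t

/-- The coefficient `𝓘_m(t)` of `λ^m` in the inhomogeneous part of the time-convolutionless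
master equation. -/
def Icoeff (L₀ L P : LinOp E) (m : ℕ) (t : ℝ) : LinOp E := tclCoeff L₀ L P (1 - P) m t

/-- `𝓛 e^{𝓛₀ (t_k - t_{k-1})} 𝓛 ⋯ e^{𝓛₀ (t₂ - t₁)} 𝓛 e^{𝓛₀ t₁}`, for a sequence with `t₀ = 0`. -/
def word (L₀ L : LinOp E) (t : ℕ → ℝ) : ℕ → LinOp E
  | 0 => 1
  | k + 1 => L * NormedSpace.exp ((t (k + 1) - t k) • L₀) * word L₀ L t k

/-- In the word `P e^{-𝓛₀ t_k} 𝓛 e^{𝓛₀ (t_k - t_{k-1})} ⋯ 𝓛 e^{𝓛₀ t₁} X` the left-most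
`e^{-𝓛₀ t_k}` can be omitted, for `k = 1, …, K` and all `0 ≤ t₁ ≤ ⋯ ≤ t_k`. -/
def CanOmit (L₀ L P X : LinOp E) (K : ℕ) : Prop :=
  ∀ k : ℕ, 1 ≤ k → k ≤ K → ∀ t : ℕ → ℝ, Monotone t → t 0 = 0 →
    P * NormedSpace.exp ((-t k) • L₀) * word L₀ L t k * X = P * word L₀ L t k * X

/-- Relaxation conditions of order `K`, with `e^{𝓛₀ t} → Λ` as `t → +∞`. -/
def RelaxationConditions (L₀ L P Λ : LinOp E) (K : ℕ) : Prop :=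
  Tendsto (fun t : ℝ => NormedSpace.exp (t • L₀)) atTop (𝓝 Λ) ∧ CanOmit L₀ L P P K

/-- Enhanced relaxation conditions of order `K`. -/
def EnhancedRelaxationConditions (L₀ L P Λ : LinOp E) (K : ℕ) : Prop :=
  RelaxationConditions L₀ L P Λ K ∧ CanOmit L₀ L P (1 - P) K

/-- `S` is the pseudoinverse `A^{(-1)}`, where `F` is the projector onto the image of `A` and
`1 - F` the projector onto its kernel. -/
def IsPseudoinverse (A F S : LinOp E) : Prop :=
  S * A = F ∧ S * (1 - F) = 0 ∧ (1 - F) * S = 0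

/-- `(e^{sA} - 1) / A`, the value at `A` of the entire function `z ↦ (e^{sz} - 1) / z`. -/
def expSubOneDiv (s : ℝ) (A : LinOp E) : LinOp E :=
  ∫ u in (0 : ℝ)..s, NormedSpace.exp (u • A)

/-- The renormalization map `𝓡 = P (1 + λ 𝓛 𝓛₀^{(-1)} (Λ - 1))`, where `S = 𝓛₀^{(-1)}`. -/
def renormalization (L P Λ S : LinOp E) (lam : ℝ) : LinOp E :=
  P * (1 + lam • (L * S * (Λ - 1)))

/-- `ρ` solves `dρ/dt = λ 𝓛(t) ρ(t)` on `[0, +∞)`. -/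
def IsSolution (L₀ L : LinOp E) (lam : ℝ) (ρ : ℝ → E) : Prop :=
  ∀ t : ℝ, 0 ≤ t →
    HasDerivWithinAt ρ (lam • (interaction L₀ L t (ρ t))) (Set.Ici 0) t

end TCL

end

/-! Write `V(t) = exp(t(L₀ + λL))`, `J(t) = ∫₀ᵗ V`, let `S` be the pseudoinverse of `L₀`, and put `κ
= -P L S L Λ`. The omission condition for `k = 1`, taken for `P` and `Q` together, says `P e^{-L₀t}
L = P L`; hence the reduced evolution is `P + λ P L J(t)`. Vanishing of the first-order limits means
`P L Λ = 0`, and then the second-order limits are `κ P` and `κ Q`.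

Since `V - 1 = (L₀ + λL) J`, one has `J = Λ J + S (V - 1) - λ S L J`. Substituting this repeatedly
expands `λ P L J` into `λ P L S (V - 1)`, the secular term `λ² κ J` and terms of order three and
higher. For `t ≤ b λ⁻²` the integral `J` is `O(λ⁻²)`, so the only higher term that could spoil an
`O(λ²)` error is `λ³ J`.

The third-order coefficients grow at most linearly in `t`. If they tend to `0`, both the slope and
the constant part vanish, which yields `κ L = κ P L` and `P L S L S L Λ = P L S S L Λ L Λ`
(`third_order_relations`). The second identity trades the `λ³ J` term for bounded terms of order
`λ²` (`reduced_expansion`). The first closes the equation: `κ V` equals `κ P` applied to the reduced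
evolution, plus `κ Q` (`effective_reduced`). Solving this linear equation gives the asymptotics
(`exists_norm_reduced_sub_le`), with initial value `P - λ P L S`, the renormalization. The leftover
`λ P L S V` is `O(|λ| e^{-γt} + λ²)` because `S Λ = 0`; it is negligible once `t ≥ |λ|^{-ε}`.

All this needs a bound on `V` uniform in `λ` and `t ≥ 0`. It comes from contractivity of the dual
(Heisenberg) semigroup and trace duality (`exists_norm_exp_le_of_isGKSL`). -/

section Relaxation

/-! ### Semigroups that converge to a projector -/

variable {A : Type*} [NormedRing A] [NormedAlgebra ℝ A] [CompleteSpace A]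

theorem exp_add_smul (a : A) (s t : ℝ) :
    NormedSpace.exp ((s + t) • a) = NormedSpace.exp (s • a) * NormedSpace.exp (t • a) := by
  let _ : NormedAlgebra ℚ A := NormedAlgebra.restrictScalars ℚ ℝ A
  rw [add_smul, NormedSpace.exp_add_of_commute]
  exact ((Commute.refl a).smul_left s).smul_right t

theorem exp_neg_smul_mul_exp_smul (a : A) (t : ℝ) :
    NormedSpace.exp ((-t) • a) * NormedSpace.exp (t • a) = 1 := by
  rw [← exp_add_smul]; simp

theorem exp_smul_mul_exp_neg_smul (a : A) (t : ℝ) :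
    NormedSpace.exp (t • a) * NormedSpace.exp ((-t) • a) = 1 := by
  rw [← exp_add_smul]; simp

theorem continuous_exp_smul (a : A) : Continuous fun t : ℝ => NormedSpace.exp (t • a) :=
  continuous_iff_continuousAt.2 fun t => (hasDerivAt_exp_smul_const (𝕂 := ℝ) a t).continuousAt

/-- The semigroup `e^{ta}` relaxes to `Λ`. -/
def Relaxes (a Λ : A) : Prop := Tendsto (fun t : ℝ => NormedSpace.exp (t • a)) atTop (𝓝 Λ)

variable {a Λ : A}

namespace Relaxes

theorem exp_mul (h : Relaxes a Λ) (s : ℝ) : NormedSpace.exp (s • a) * Λ = Λ := by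
  have h1 : Tendsto (fun t : ℝ => NormedSpace.exp ((s + t) • a)) atTop (𝓝 Λ) :=
    Tendsto.comp (g := fun t : ℝ => NormedSpace.exp (t • a)) h (tendsto_atTop_add_const_left _ s tendsto_id)
  simp_rw [exp_add_smul] at h1
  exact tendsto_nhds_unique (Tendsto.const_mul _ h) h1

theorem mul_exp (h : Relaxes a Λ) (s : ℝ) : Λ * NormedSpace.exp (s • a) = Λ := by
  have h1 : Tendsto (fun t : ℝ => NormedSpace.exp ((t + s) • a)) atTop (𝓝 Λ) :=
    Tendsto.comp (g := fun t : ℝ => NormedSpace.exp (t • a)) h (tendsto_atTop_add_const_right _ s tendsto_id)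
  simp_rw [exp_add_smul] at h1
  exact tendsto_nhds_unique (Tendsto.mul_const _ h) h1

theorem idem (h : Relaxes a Λ) : Λ * Λ = Λ := by
  have h1 : Tendsto (fun t : ℝ => NormedSpace.exp (t • a) * Λ) atTop (𝓝 (Λ * Λ)) :=
    Tendsto.mul_const _ h
  simp_rw [h.exp_mul] at h1
  exact tendsto_nhds_unique h1 tendsto_const_nhds

theorem gen_mul (h : Relaxes a Λ) : a * Λ = 0 := by
  have h1 := (hasDerivAt_exp_smul_const (𝕂 := ℝ) a 0).mul_const Λ
  simp_rw [h.exp_mul] at h1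
  simpa using h1.unique (hasDerivAt_const _ _)

theorem mul_gen (h : Relaxes a Λ) : Λ * a = 0 := by
  have h1 := (hasDerivAt_exp_smul_const (𝕂 := ℝ) a 0).const_mul Λ
  simp_rw [h.mul_exp] at h1
  simpa using h1.unique (hasDerivAt_const _ _)

/-- Relaxation is exponentially fast. -/
theorem exists_decay (h : Relaxes a Λ) : ∃ c γ : ℝ, 0 < c ∧ 0 < γ ∧
    ∀ t : ℝ, 0 ≤ t → ‖NormedSpace.exp (t • a) - Λ‖ ≤ c * Real.exp (-(γ * t)) := by
  -- The deviation from the limit is itself multiplicative in time, so one time at which its norm is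
  -- at most `1/2` forces geometric decay.
  set D : ℝ → A := fun t => NormedSpace.exp (t • a) - Λ with hD
  have hadd : ∀ s t, D (s + t) = D s * D t := fun s t => by
    simp only [hD, exp_add_smul, mul_sub, sub_mul, h.exp_mul, h.mul_exp, h.idem]; abel
  have hlim : Tendsto (fun t => ‖D t‖) atTop (𝓝 0) := by
    have := (Tendsto.sub_const h Λ).norm
    simpa using this
  obtain ⟨T, hT0, hT⟩ : ∃ T : ℝ, 0 < T ∧ ‖D T‖ ≤ 1 / 2 :=
    ((eventually_gt_atTop 0).and (hlim.eventually (ge_mem_nhds (by norm_num)))).exists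
  obtain ⟨M, hM⟩ : ∃ M, ∀ t ∈ Set.Icc 0 T, ‖D t‖ ≤ M :=
    isCompact_Icc.exists_bound_of_continuousOn ((continuous_exp_smul a).sub continuous_const).continuousOn
  have hM0 : 0 ≤ M := (norm_nonneg _).trans (hM 0 ⟨le_rfl, hT0.le⟩)
  have hpow : ∀ (k : ℕ) (r : ℝ), r ∈ Set.Icc 0 T → ‖D (k * T + r)‖ ≤ (1 / 2) ^ k * M := by
    intro k r hr
    induction k with
    | zero => simpa using hM r hr
    | succ k ih =>
      have : ((k + 1 : ℕ) : ℝ) * T + r = T + (k * T + r) := by push_cast; ring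
      rw [this, hadd, pow_succ', mul_assoc]
      exact (norm_mul_le _ _).trans (mul_le_mul hT ih (norm_nonneg _) (by norm_num))
  -- The factor 2 pays for rounding `t / T` down; the `+ 1` only makes the constant positive.
  refine ⟨2 * M + 1, Real.log 2 / T, by linarith, div_pos (Real.log_pos (by norm_num)) hT0,
    fun t ht => ?_⟩
  set k := ⌊t / T⌋₊
  have hk1 : (k : ℝ) * T ≤ t := (le_div_iff₀ hT0).1 (Nat.floor_le (div_nonneg ht hT0.le))
  have hk2 : t < (k + 1) * T := (div_lt_iff₀ hT0).1 (Nat.lt_floor_add_one _)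
  have h1 := hpow k (t - k * T) ⟨by linarith, by linarith⟩
  rw [add_sub_cancel] at h1
  refine h1.trans ?_
  have h2 : ((1 : ℝ) / 2) ^ k = Real.exp (-(Real.log 2 * k)) := by
    rw [Real.exp_neg, mul_comm, Real.exp_nat_mul, Real.exp_log (by norm_num)]; simp
  have h3 : Real.exp (-(Real.log 2 * k)) ≤ 2 * Real.exp (-(Real.log 2 / T * t)) := by
    nth_rewrite 2 [← Real.exp_log (show (0 : ℝ) < 2 by norm_num)]
    rw [← Real.exp_add, Real.exp_le_exp]
    have : t / T ≤ k + 1 := (Nat.lt_floor_add_one _).le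
    have h4 := mul_le_mul_of_nonneg_left this (Real.log_nonneg (show (1 : ℝ) ≤ 2 by norm_num))
    have h5 : Real.log 2 / T * t = Real.log 2 * (t / T) := by ring
    rw [h5]; linarith
  rw [h2]
  have := Real.exp_pos (-(Real.log 2 / T * t))
  nlinarith [mul_le_mul_of_nonneg_right h3 hM0]

theorem integrableOn_exp_sub (h : Relaxes a Λ) :
    MeasureTheory.IntegrableOn (fun t : ℝ => NormedSpace.exp (t • a) - Λ) (Set.Ioi 0) := by
  obtain ⟨c, γ, _, hγ, hd⟩ := h.exists_decay
  have h1 : MeasureTheory.IntegrableOn (fun t : ℝ => c * Real.exp (-γ * t)) (Set.Ioi 0) :=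
    (exp_neg_integrableOn_Ioi 0 hγ).const_mul c
  refine MeasureTheory.Integrable.mono' h1
    ((continuous_exp_smul a).sub continuous_const).aestronglyMeasurable ?_
  refine (MeasureTheory.ae_restrict_iff' measurableSet_Ioi).2 (Eventually.of_forall fun t ht => ?_)
  simpa using hd t (le_of_lt ht)

/-- The pseudoinverse of the generator of a relaxing semigroup. -/
theorem exists_pseudoinverse (h : Relaxes a Λ) :
    ∃ S : A, S * a = 1 - Λ ∧ a * S = 1 - Λ ∧ S * Λ = 0 ∧ Λ * S = 0 := by
  have hint := h.integrableOn_exp_sub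
  have hlim : Tendsto (fun t : ℝ => NormedSpace.exp (t • a)) atTop (𝓝 Λ) := h
  -- Integrating the derivative of `e^{ta}` over the half-line gives `Λ - 1`, whence the sign.
  refine ⟨-∫ t in Set.Ioi (0 : ℝ), (NormedSpace.exp (t • a) - Λ), ?_, ?_, ?_, ?_⟩
  · have h1 := MeasureTheory.integral_Ioi_of_hasDerivAt_of_tendsto (a := (0 : ℝ))
      (f := fun t : ℝ => NormedSpace.exp (t • a)) (f' := fun t => (NormedSpace.exp (t • a) - Λ) * a)
      (continuous_exp_smul a).continuousWithinAt
      (fun t _ => by simpa [sub_mul, h.mul_gen] using hasDerivAt_exp_smul_const (𝕂 := ℝ) a t)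
      (hint.mul_const a) hlim
    rw [integral_mul_const_of_integrable hint] at h1
    rw [neg_mul, h1]; simp
  · have h1 := MeasureTheory.integral_Ioi_of_hasDerivAt_of_tendsto (a := (0 : ℝ))
      (f := fun t : ℝ => NormedSpace.exp (t • a)) (f' := fun t => a * (NormedSpace.exp (t • a) - Λ))
      (continuous_exp_smul a).continuousWithinAt
      (fun t _ => by simpa [mul_sub, h.gen_mul] using hasDerivAt_exp_smul_const' (𝕂 := ℝ) a t)
      (hint.const_mul a) hlim
    rw [integral_const_mul_of_integrable hint] at h1
    rw [mul_neg, h1]; simp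
  · rw [neg_mul, ← integral_mul_const_of_integrable hint]
    simp [sub_mul, h.exp_mul, h.idem]
  · rw [mul_neg, ← integral_const_mul_of_integrable hint]
    simp [mul_sub, h.mul_exp, h.idem]

/-- Variation of constants, in the part of the space on which the semigroup decays. -/
theorem duhamel (h : Relaxes a Λ) {e r : ℝ → A} (he : ∀ t, HasDerivAt e (a * e t + r t) t)
    (hr : Continuous r) (T t : ℝ) :
    (1 - Λ) * e t = (NormedSpace.exp ((t - T) • a) - Λ) * e T +
      ∫ s in T..t, (NormedSpace.exp ((t - s) • a) - Λ) * r s := by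
  -- Subtracting `Λ` from the propagator does not disturb the cancellation, because `Λ a = 0`.
  have hd : ∀ s, HasDerivAt (fun s => (NormedSpace.exp ((t - s) • a) - Λ) * e s)
      ((NormedSpace.exp ((t - s) • a) - Λ) * r s) s := by
    intro s
    have h1 := (hasDerivAt_exp_smul_const (𝕂 := ℝ) a (t - s)).scomp s
      ((hasDerivAt_id s).const_sub t)
    have h2 := (h1.sub_const Λ).mul (he s)
    refine HasDerivAt.congr_deriv h2 ?_
    simp only [Function.comp_apply, neg_smul, one_smul, mul_add, sub_mul, neg_mul]
    rw [← mul_assoc Λ, h.mul_gen, mul_assoc]; simp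
  rw [intervalIntegral.integral_eq_sub_of_hasDerivAt (fun s _ => hd s)]
  · simp
  · refine Continuous.intervalIntegrable ?_ _ _
    exact (((continuous_exp_smul a).comp (continuous_const.sub continuous_id)).sub
      continuous_const).mul hr

/-- The exponential kernel has total mass at most `c / γ`, so the bound does not depend on the
length of the time interval. -/
theorem norm_integral_le_of_decay {c γ : ℝ} (hγ : 0 < γ) (hc : 0 < c)
    (hd : ∀ t : ℝ, 0 ≤ t → ‖NormedSpace.exp (t • a) - Λ‖ ≤ c * Real.exp (-(γ * t)))
    {r : ℝ → A} {T t η : ℝ} (hT : T ≤ t) (hη : 0 ≤ η) (hrη : ∀ s ∈ Set.Ioc T t, ‖r s‖ ≤ η) :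
    ‖∫ s in T..t, (NormedSpace.exp ((t - s) • a) - Λ) * r s‖ ≤ c / γ * η := by
  have hi : ∀ s, HasDerivAt (fun s => c / γ * η * Real.exp (-(γ * (t - s))))
      (c * Real.exp (-(γ * (t - s))) * η) s := by
    intro s
    have h1 : HasDerivAt (fun s => -(γ * (t - s))) γ s := by
      have := (((hasDerivAt_id s).const_sub t).const_mul γ).neg
      exact this.congr_deriv (by simp)
    refine (h1.exp.const_mul (c / γ * η)).congr_deriv ?_
    field_simp
  have hcont : Continuous fun s => c * Real.exp (-(γ * (t - s))) * η := by fun_prop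
  refine (intervalIntegral.norm_integral_le_of_norm_le hT (g := fun s => c * Real.exp (-(γ * (t - s))) * η)
    (Eventually.of_forall fun s hs => ?_) (hcont.intervalIntegrable _ _)).trans ?_
  · refine (norm_mul_le _ _).trans ?_
    exact mul_le_mul (hd _ (by linarith [hs.2])) (hrη s hs) (norm_nonneg _) (by positivity)
  · rw [intervalIntegral.integral_eq_sub_of_hasDerivAt (fun s _ => hi s) (hcont.intervalIntegrable _ _)]
    have : 0 ≤ c / γ * η * Real.exp (-(γ * (t - T))) := by positivity
    simp only [sub_self, mul_zero, neg_zero, Real.exp_zero, mul_one]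
    linarith

/-- In Duhamel's formula started at a late time `T`, the source is already small after `T`, and the
memory of `e T` decays. -/
theorem tendsto_zero_of_hasDerivAt (h : Relaxes a Λ) {e r : ℝ → A}
    (he : ∀ t, HasDerivAt e (a * e t + r t) t) (hr : Continuous r)
    (hr0 : Tendsto r atTop (𝓝 0)) : Tendsto (fun t => (1 - Λ) * e t) atTop (𝓝 0) := by
  obtain ⟨c, γ, hc, hγ, hd⟩ := h.exists_decay
  rw [Metric.tendsto_atTop]
  intro δ hδ
  have hη : 0 < δ / 2 / (c / γ) / 2 := by positivity
  obtain ⟨T, hT⟩ := (Metric.tendsto_atTop.1 hr0) _ hη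
  have hlim : Tendsto (fun t : ℝ => c * Real.exp (-(γ * (t - T))) * ‖e T‖) atTop (𝓝 0) := by
    have h1 : Tendsto (fun t : ℝ => γ * (t - T)) atTop atTop :=
      Tendsto.const_mul_atTop hγ (tendsto_atTop_add_const_right _ (-T) tendsto_id)
    have := ((Real.tendsto_exp_neg_atTop_nhds_zero.comp h1).const_mul c).mul_const ‖e T‖
    simpa using this
  obtain ⟨N, hN⟩ := (Metric.tendsto_atTop.1 hlim) (δ / 2) (by positivity)
  refine ⟨max T N, fun t ht => ?_⟩
  have h1 := hN t ((le_max_right _ _).trans ht)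
  have hTt := (le_max_left _ _).trans ht
  rw [Real.dist_0_eq_abs] at h1
  have h2 := norm_integral_le_of_decay hγ hc hd hTt hη.le (r := r) fun s hs => by
    simpa using (hT s hs.1.le).le
  have h3 : c / γ * (δ / 2 / (c / γ) / 2) = δ / 4 := by field_simp; norm_num
  rw [h3] at h2
  rw [dist_zero_right, h.duhamel he hr T t]
  have h4 : ‖(NormedSpace.exp ((t - T) • a) - Λ) * e T‖ ≤ c * Real.exp (-(γ * (t - T))) * ‖e T‖ :=
    (norm_mul_le _ _).trans (by gcongr; exact hd _ (by linarith))
  have := norm_add_le ((NormedSpace.exp ((t - T) • a) - Λ) * e T)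
    (∫ s in T..t, (NormedSpace.exp ((t - s) • a) - Λ) * r s)
  linarith [le_abs_self (c * Real.exp (-(γ * (t - T))) * ‖e T‖)]

end Relaxes

end Relaxation

/-! ### Weak-coupling expansion of the reduced evolution -/

section Perturbation

section Algebra

variable {A : Type*} [Ring A] {a l P Λ S J W : A}

/-- Iterates `J = Λ J + S W - S l J`. The third-order secular term `P l S S l Λ l Λ J` is rewritten
by using the same identity backwards and then `Λ l J = Λ W`; what remains of third order or less,
besides the `κ J` term, multiplies the bounded `W`, and `J` reappears only at fourth order. -/
theorem reduced_expansion (hSa : S * a = 1 - Λ) (hΛa : Λ * a = 0) (h1 : P * l * Λ = 0)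
    (h3 : P * l * S * l * S * l * Λ = P * l * S * S * l * Λ * l * Λ) (hW : W = a * J + l * J) :
    P * l * J = P * l * S * W + (-(P * l * S * l * Λ)) * J
      + ((P * l * S * S * l * Λ - P * l * S * l * S) * W
      + (P * l * S * l * S * l * S - P * l * S * S * l * Λ * l * S) * W
      + (P * l * S * S * l * Λ * l * S * l - P * l * S * l * S * l * S * l) * J) := by
  have k1 : J = Λ * J + S * W - S * l * J := by
    rw [hW, mul_add, ← mul_assoc, hSa]; noncomm_ring
  have k2 : Λ * W = Λ * l * J := by
    rw [hW, mul_add, ← mul_assoc, hΛa, zero_mul, zero_add, mul_assoc]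
  have e1 := congrArg (P * l * ·) k1
  have e2 := congrArg (P * l * S * l * ·) k1
  have e3 := congrArg (P * l * S * l * S * l * ·) k1
  have e4 := congrArg (P * l * S * S * l * Λ * l * ·) k1
  have e5 := congrArg (P * l * S * S * l * ·) k2
  simp only [mul_add, mul_sub, ← mul_assoc] at e1 e2 e3 e4 e5
  rw [h1, zero_mul] at e1
  rw [h3] at e3
  simp only [sub_mul, neg_mul]
  linear_combination (norm := abel) e1 - e2 + e3 - e4 - e5

/-- Closes the equation: `κ` kills `a`, and `κ l = κ P l` lets `κ` see the evolution only through
the reduced quantity `p`, up to the constant source `κ (1 - P)`. -/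
theorem effective_reduced {κ p : A} (hκa : κ * a = 0) (hκl : κ * l = κ * P * l)
    (hW : W = a * J + l * J) (hp : p = P + P * l * J) (hP : P * P = P) :
    κ * (1 + W) = κ * P * p + κ * (1 - P) := by
  have e1 := congrArg (κ * ·) hW
  simp only [mul_add, ← mul_assoc, hκa, hκl] at e1
  rw [mul_add, e1, hp, mul_add, mul_assoc κ P P, hP, ← mul_assoc, ← mul_assoc, mul_assoc κ P P, hP]
  noncomm_ring

end Algebra

variable {A : Type*} [NormedRing A] [NormedAlgebra ℝ A] [CompleteSpace A]

theorem intervalIntegral_const_mul (c : A) {f : ℝ → A} (hf : Continuous f) (s t : ℝ) :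
    ∫ u in s..t, c * f u = c * ∫ u in s..t, f u :=
  (ContinuousLinearMap.mul ℝ A c).intervalIntegral_comp_comm (hf.intervalIntegrable s t)

theorem exp_smul_sub_one_eq (g : A) (t : ℝ) :
    NormedSpace.exp (t • g) - 1 = g * ∫ s in (0 : ℝ)..t, NormedSpace.exp (s • g) := by
  have h := intervalIntegral.integral_eq_sub_of_hasDerivAt (a := (0 : ℝ)) (b := t)
    (fun s _ => hasDerivAt_exp_smul_const' (𝕂 := ℝ) g s)
    ((continuous_const.mul (continuous_exp_smul g)).intervalIntegrable _ _)
  rw [← intervalIntegral_const_mul g (continuous_exp_smul g), h]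
  simp

theorem hasDerivAt_integral_exp_smul (g : A) (t : ℝ) :
    HasDerivAt (fun t => ∫ s in (0 : ℝ)..t, NormedSpace.exp (s • g)) (NormedSpace.exp (t • g)) t :=
  ((continuous_exp_smul g).integral_hasStrictDerivAt 0 t).hasDerivAt

/-- The interaction-picture evolution seen through `P`, when the left-most backward evolution can
be omitted. -/
theorem reduced_eq_integral {a l P : A}
    (hom : ∀ t : ℝ, 0 ≤ t → P * NormedSpace.exp ((-t) • a) * l = P * l) {t : ℝ} (ht : 0 ≤ t) :
    P * NormedSpace.exp ((-t) • a) * NormedSpace.exp (t • (a + l)) =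
      P + P * l * ∫ s in (0 : ℝ)..t, NormedSpace.exp (s • (a + l)) := by
  have hd : ∀ s ∈ Set.uIcc 0 t, HasDerivAt
      (fun s : ℝ => P * NormedSpace.exp ((-s) • a) * NormedSpace.exp (s • (a + l)))
      (P * l * NormedSpace.exp (s • (a + l))) s := by
    intro s hs
    rw [Set.uIcc_of_le ht] at hs
    have h1 := (hasDerivAt_exp_smul_const (𝕂 := ℝ) a (-s)).scomp s (hasDerivAt_neg s)
    have h2 := (h1.const_mul P).mul (hasDerivAt_exp_smul_const' (𝕂 := ℝ) (a + l) s)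
    refine HasDerivAt.congr_deriv h2 ?_
    rw [← hom s hs.1]
    simp only [Function.comp_apply, neg_smul, one_smul]
    noncomm_ring
  have h := intervalIntegral.integral_eq_sub_of_hasDerivAt hd
    ((continuous_const.mul (continuous_exp_smul _)).intervalIntegrable _ _)
  rw [intervalIntegral_const_mul _ (continuous_exp_smul _)] at h
  rw [h]; simp

/-- Weak-coupling asymptotics of the reduced evolution on the time scale `λ⁻²`. -/
theorem exists_norm_reduced_sub_le {a L P Λ S κ : A} (hP : P * P = P) (hΛ : Relaxes a Λ)
    (hSa : S * a = 1 - Λ) (hSΛ : S * Λ = 0)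
    (hom : ∀ t : ℝ, 0 ≤ t → P * NormedSpace.exp ((-t) • a) * L = P * L)
    (h1 : P * L * Λ = 0) (hκ : κ = -(P * L * S * L * Λ)) (hκL : κ * L = κ * P * L)
    (h3 : P * L * S * L * S * L * Λ = P * L * S * S * L * Λ * L * Λ)
    {c γ : ℝ} (hc : 0 < c) (hγ : 0 < γ)
    (hd : ∀ t : ℝ, 0 ≤ t → ‖NormedSpace.exp (t • a) - Λ‖ ≤ c * Real.exp (-(γ * t)))
    {b B : ℝ} (hb : 0 ≤ b) (hB : 0 ≤ B) :
    ∃ C : ℝ, 0 ≤ C ∧ ∀ lam : ℝ, |lam| ≤ 1 →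
      (∀ t : ℝ, 0 ≤ t → ‖NormedSpace.exp (t • (a + lam • L))‖ ≤ B) →
      ∀ t : ℝ, 0 ≤ t → lam ^ 2 * t ≤ b →
        ‖P * NormedSpace.exp ((-t) • a) * NormedSpace.exp (t • (a + lam • L)) -
          (NormedSpace.exp ((lam ^ 2 * t) • (κ * P)) * (P - lam • (P * L * S)) +
            (∫ u in (0 : ℝ)..(lam ^ 2 * t), NormedSpace.exp (u • (κ * P))) * (κ * (1 - P)))‖ ≤
        C * (|lam| * Real.exp (-(γ * t)) + lam ^ 2) := by
  obtain ⟨M, hM⟩ : ∃ M, ∀ t ∈ Set.Icc 0 b, ‖NormedSpace.exp (t • (κ * P))‖ ≤ M :=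
    isCompact_Icc.exists_bound_of_continuousOn (continuous_exp_smul (κ * P)).continuousOn
  have hM0 : 0 ≤ M := (norm_nonneg _).trans (hM 0 ⟨le_rfl, hb⟩)
  set x1 := P * L * S * S * L * Λ - P * L * S * L * S with hx1
  set x2 := P * L * S * L * S * L * S - P * L * S * S * L * Λ * L * S with hx2
  set x3 := P * L * S * S * L * Λ * L * S * L - P * L * S * L * S * L * S * L with hx3
  -- `C1` measures the initial transient, of order `|λ| e^{-γt}`; `C2` collects the contributions of
  -- order `λ²` to the remainder `h`.
  set C1 := ‖P * L * S‖ * c with hC1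
  set C2 := ‖P * L * S‖ * (c / γ * (‖L‖ * B)) + ((‖x1‖ + ‖x2‖) * (B + B) + ‖x3‖ * (b * B)) with hC2
  have hC1' : 0 ≤ C1 := by positivity
  have hC2' : 0 ≤ C2 := by positivity
  set K := κ * P with hK
  -- Besides `h` itself, the error contains `h` fed through the effective dynamics: integrating its
  -- bound over `[0, b λ⁻²]` with weight `λ²` gives the last summand.
  refine ⟨C1 + C2 + M * ‖K‖ * (C1 / γ + C2 * b), by positivity, fun lam hlam hbd t ht htb => ?_⟩
  set G := a + lam • L with hG
  set V : ℝ → A := fun s => NormedSpace.exp (s • G) with hV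
  set J : ℝ → A := fun t => ∫ s in (0 : ℝ)..t, NormedSpace.exp (s • G) with hJ
  -- The reduced evolution is split as `q + h`: `q` carries the initial value and the secular term,
  -- and `h` is the remainder.
  set h : ℝ → A := fun s => lam • (P * L * S * V s) +
    (lam ^ 2 • (x1 * (V s - 1)) + lam ^ 3 • (x2 * (V s - 1)) + lam ^ 4 • (x3 * J s)) with hh
  set q : ℝ → A := fun s => P - lam • (P * L * S) + lam ^ 2 • (κ * J s) with hq
  have hlam2 : lam ^ 2 ≤ 1 := (sq_le_one_iff_abs_le_one lam).2 hlam
  have hVc : Continuous V := continuous_exp_smul G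
  have hJd : ∀ s, HasDerivAt J (V s) s := hasDerivAt_integral_exp_smul G
  have hJc : Continuous J := continuous_iff_continuousAt.2 fun s => (hJd s).continuousAt
  have hhc : Continuous h := by fun_prop
  have hW : ∀ s, V s - 1 = a * J s + (lam • L) * J s := fun s => by
    rw [← add_mul, ← exp_smul_sub_one_eq]
  have hp : ∀ s, P + P * (lam • L) * J s = q s + h s := fun s => by
    have := reduced_expansion (P := P) hSa hΛ.mul_gen (l := lam • L) (by simp [h1])
      (by simp [h3]) (hW s)
    rw [this]
    simp only [hq, hh, hx1, hx2, hx3, hκ, mul_smul_comm, smul_mul_assoc, smul_smul, sub_mul,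
      neg_mul, mul_sub, mul_one, smul_sub, smul_neg]
    match_scalars <;> ring
  have hκa : κ * a = 0 := by rw [hκ, neg_mul, mul_assoc, hΛ.mul_gen, mul_zero, neg_zero]
  have hκV : ∀ s, κ * V s = K * (q s + h s) + κ * (1 - P) := fun s => by
    rw [← effective_reduced (l := lam • L) hκa (by rw [mul_smul_comm, hκL, mul_smul_comm]) (hW s) (hp s).symm hP]
    simp
  have hJn : ∀ s, 0 ≤ s → ‖J s‖ ≤ B * s := fun s hs => by
    have := intervalIntegral.norm_integral_le_of_norm_le_const (a := 0) (b := s) (f := V) (C := B)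
      fun u hu => hbd u (by rw [Set.uIoc_of_le hs] at hu; exact hu.1.le)
    simpa [abs_of_nonneg hs] using this
  have hWn : ∀ s, 0 ≤ s → ‖V s - 1‖ ≤ B + B := fun s hs => by
    have h0 := hbd 0 le_rfl
    rw [zero_smul, NormedSpace.exp_zero] at h0
    exact (norm_sub_le _ _).trans (add_le_add (hbd s hs) h0)
  have hSV : ∀ s, 0 ≤ s → ‖P * L * S * V s‖ ≤
      ‖P * L * S‖ * (c * Real.exp (-(γ * s)) + c / γ * (|lam| * (‖L‖ * B))) := fun s hs => by
    -- As `S Λ = 0`, only the decaying part of `V` enters, and Duhamel's formula bounds it by a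
    -- transient plus `O(λ)`.
    have e : P * L * S * V s = P * L * S * ((1 - Λ) * V s) := by
      rw [sub_mul, mul_sub, one_mul, ← mul_assoc (P * L * S) Λ, mul_assoc (P * L) S Λ, hSΛ]; simp
    have hder : ∀ u, HasDerivAt V (a * V u + (lam • L) * V u) u := fun u => by
      rw [← add_mul]; exact hasDerivAt_exp_smul_const' (𝕂 := ℝ) G u
    rw [e]
    refine (norm_mul_le _ _).trans (mul_le_mul_of_nonneg_left ?_ (norm_nonneg _))
    rw [hΛ.duhamel hder (by fun_prop) 0 s]
    refine (norm_add_le _ _).trans (add_le_add ?_ ?_)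
    · simpa [hV] using hd s hs
    · refine Relaxes.norm_integral_le_of_decay hγ hc hd hs (by positivity) fun u hu => ?_
      refine (norm_mul_le _ _).trans ?_
      rw [norm_smul, Real.norm_eq_abs, mul_assoc]
      exact mul_le_mul_of_nonneg_left
        (mul_le_mul_of_nonneg_left (hbd u hu.1.le) (norm_nonneg _)) (abs_nonneg _)
  have hhn : ∀ s, 0 ≤ s → lam ^ 2 * s ≤ b →
      ‖h s‖ ≤ C1 * |lam| * Real.exp (-(γ * s)) + C2 * lam ^ 2 := fun s hs hsb => by
    have n1 : ‖lam • (P * L * S * V s)‖ ≤ |lam| *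
        (‖P * L * S‖ * (c * Real.exp (-(γ * s)) + c / γ * (|lam| * (‖L‖ * B)))) := by
      rw [norm_smul, Real.norm_eq_abs]
      exact mul_le_mul_of_nonneg_left (hSV s hs) (abs_nonneg _)
    have n2 : ‖lam ^ 2 • (x1 * (V s - 1))‖ ≤ lam ^ 2 * (‖x1‖ * (B + B)) := by
      rw [norm_smul, Real.norm_of_nonneg (sq_nonneg lam)]
      gcongr
      exact (norm_mul_le _ _).trans (mul_le_mul_of_nonneg_left (hWn s hs) (norm_nonneg _))
    have n3 : ‖lam ^ 3 • (x2 * (V s - 1))‖ ≤ lam ^ 2 * (‖x2‖ * (B + B)) := by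
      rw [norm_smul, norm_pow, Real.norm_eq_abs, ← sq_abs]
      refine mul_le_mul (pow_le_pow_of_le_one (abs_nonneg _) hlam (by norm_num)) ?_
        (norm_nonneg _) (by positivity)
      exact (norm_mul_le _ _).trans (mul_le_mul_of_nonneg_left (hWn s hs) (norm_nonneg _))
    have n4 : ‖lam ^ 4 • (x3 * J s)‖ ≤ lam ^ 2 * (‖x3‖ * (b * B)) := by
      rw [norm_smul, Real.norm_of_nonneg (by positivity)]
      calc lam ^ 4 * ‖x3 * J s‖ ≤ lam ^ 4 * (‖x3‖ * (B * s)) := by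
            gcongr
            exact (norm_mul_le _ _).trans (mul_le_mul_of_nonneg_left (hJn s hs) (norm_nonneg _))
        _ = lam ^ 2 * (‖x3‖ * ((lam ^ 2 * s) * B)) := by ring
        _ ≤ _ := by gcongr
    calc ‖h s‖ ≤ _ := norm_add_le_of_le n1 (norm_add_le_of_le (norm_add_le_of_le n2 n3) n4)
      _ = _ := by rw [hC1, hC2, ← sq_abs lam]; ring
  -- Variation of constants for `q' = λ² (K (q + h) + κ (1 - P))`, with `q 0 = P - λ P L S`.
  have hqr : q t - (NormedSpace.exp ((lam ^ 2 * t) • K) * (P - lam • (P * L * S)) +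
      (∫ u in (0 : ℝ)..(lam ^ 2 * t), NormedSpace.exp (u • K)) * (κ * (1 - P))) =
      ∫ s in (0 : ℝ)..t, lam ^ 2 • (NormedSpace.exp ((lam ^ 2 * (t - s)) • K) * (K * h s)) := by
    have hder : ∀ s, HasDerivAt (fun s => NormedSpace.exp ((lam ^ 2 * (t - s)) • K) * q s +
        (∫ u in (0 : ℝ)..(lam ^ 2 * (t - s)), NormedSpace.exp (u • K)) * (κ * (1 - P)))
        (lam ^ 2 • (NormedSpace.exp ((lam ^ 2 * (t - s)) • K) * (K * h s))) s := fun s => by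
      have d0 : HasDerivAt (fun s => lam ^ 2 * (t - s)) (-lam ^ 2) s :=
        (((hasDerivAt_id s).const_sub t).const_mul (lam ^ 2)).congr_deriv (by simp)
      have d1 := (hasDerivAt_exp_smul_const (𝕂 := ℝ) K (lam ^ 2 * (t - s))).scomp s d0
      have d2 := ((hasDerivAt_integral_exp_smul K (lam ^ 2 * (t - s))).scomp s d0).mul_const
        (κ * (1 - P))
      have d3 : HasDerivAt q (lam ^ 2 • (κ * V s)) s :=
        (((hJd s).const_mul κ).const_smul (lam ^ 2)).const_add _
      refine HasDerivAt.congr_deriv ((d1.mul d3).add d2) ?_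
      rw [hκV s]
      simp only [Function.comp_apply, neg_smul, smul_mul_assoc, mul_smul_comm, neg_mul, mul_add,
        smul_add, mul_assoc]
      abel
    rw [intervalIntegral.integral_eq_sub_of_hasDerivAt (fun s _ => hder s)]
    · simp [hq, hJ]
    · refine Continuous.intervalIntegrable ?_ _ _
      have h1 : Continuous fun s => NormedSpace.exp ((lam ^ 2 * (t - s)) • K) :=
        (continuous_exp_smul K).comp (by fun_prop)
      fun_prop
  have hi : ∀ s, HasDerivAt
      (fun s => lam ^ 2 * M * ‖K‖ * (-(C1 * |lam| / γ) * Real.exp (-(γ * s)) + C2 * lam ^ 2 * s))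
      (lam ^ 2 * M * ‖K‖ * (C1 * |lam| * Real.exp (-(γ * s)) + C2 * lam ^ 2)) s := fun s => by
    have d0 : HasDerivAt (fun s => -(γ * s)) (-γ) s :=
      ((hasDerivAt_id s).const_mul γ).neg.congr_deriv (by simp)
    refine (((d0.exp.const_mul (-(C1 * |lam| / γ))).add
      ((hasDerivAt_id s).const_mul (C2 * lam ^ 2))).const_mul _).congr_deriv ?_
    field_simp
  have hic : Continuous fun s =>
      lam ^ 2 * M * ‖K‖ * (C1 * |lam| * Real.exp (-(γ * s)) + C2 * lam ^ 2) := by fun_prop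
  have hqrn : ‖q t - (NormedSpace.exp ((lam ^ 2 * t) • K) * (P - lam • (P * L * S)) +
      (∫ u in (0 : ℝ)..(lam ^ 2 * t), NormedSpace.exp (u • K)) * (κ * (1 - P)))‖ ≤
      lam ^ 2 * (M * ‖K‖ * (C1 / γ + C2 * b)) := by
    rw [hqr]
    refine (intervalIntegral.norm_integral_le_of_norm_le ht
      (Eventually.of_forall fun s hs => ?_) (hic.intervalIntegrable _ _)).trans ?_
    · have hsb : lam ^ 2 * s ≤ b := (mul_le_mul_of_nonneg_left hs.2 (sq_nonneg _)).trans htb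
      have hts : lam ^ 2 * (t - s) ∈ Set.Icc 0 b :=
        ⟨mul_nonneg (sq_nonneg _) (by linarith [hs.2]),
          (mul_le_mul_of_nonneg_left (by linarith [hs.1]) (sq_nonneg _)).trans htb⟩
      rw [norm_smul, Real.norm_of_nonneg (sq_nonneg lam), mul_assoc (lam ^ 2), mul_assoc (lam ^ 2)]
      refine mul_le_mul_of_nonneg_left ?_ (sq_nonneg _)
      rw [mul_assoc M]
      exact (norm_mul_le _ _).trans (mul_le_mul (hM _ hts) ((norm_mul_le K (h s)).trans
        (mul_le_mul_of_nonneg_left (hhn s hs.1.le hsb) (norm_nonneg _))) (norm_nonneg _) hM0)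
    · rw [intervalIntegral.integral_eq_sub_of_hasDerivAt (fun s _ => hi s)
        (hic.intervalIntegrable _ _)]
      have e1 : C1 * |lam| / γ * (1 - Real.exp (-(γ * t))) ≤ C1 / γ := by
        have : C1 * |lam| / γ ≤ C1 / γ := by
          gcongr; exact mul_le_of_le_one_right hC1' hlam
        have h0 := Real.exp_pos (-(γ * t))
        exact (mul_le_of_le_one_right (by positivity) (by linarith)).trans this
      have e2 : C2 * (lam ^ 2 * t) ≤ C2 * b := by gcongr
      have e3 : 0 ≤ lam ^ 2 * M * ‖K‖ := by positivity
      have e4 := mul_le_mul_of_nonneg_left (add_le_add e1 e2) e3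
      simp only [mul_zero, neg_zero, Real.exp_zero, add_zero]
      linarith
  have hfin := norm_add_le_of_le (hhn t ht htb) hqrn
  rw [reduced_eq_integral (l := lam • L) (fun s hs => by
    rw [mul_smul_comm, hom s hs, mul_smul_comm]) ht, hp t]
  have e : ∀ x y z : A, x + y - z = y + (x - z) := fun x y z => by abel
  rw [e]
  refine hfin.trans ?_
  have hE := Real.exp_pos (-(γ * t))
  have : 0 ≤ |lam| * Real.exp (-(γ * t)) := by positivity
  have hX : 0 ≤ M * ‖K‖ * (C1 / γ + C2 * b) := by positivity
  nlinarith [mul_nonneg hC2' this, mul_nonneg hX this, mul_nonneg hC1' (sq_nonneg lam)]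

end Perturbation

/-! ### Compositions of 1, 2 and 3 -/

theorem Composition.sum_blocks_one {M : Type*} [AddCommMonoid M] (f : List ℕ → M) :
    ∑ c : Composition 1, f c.blocks = f [1] := by
  have : (Finset.univ : Finset (Composition 1)) = {⟨[1], by simp, rfl⟩} := by
    refine (Finset.eq_univ_iff_forall.2 fun c => ?_).symm
    have hpos : ∀ i ∈ c.blocks, 0 < i := fun i hi => c.blocks_pos hi
    have hsum := c.blocks_sum
    simp only [Finset.mem_singleton, Composition.ext_iff]
    generalize c.blocks = l at hpos hsum ⊢
    match l, hpos, hsum with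
    | [], _, hsum => simp at hsum
    | [x], _, hsum => simpa using hsum
    | x :: y :: l, hpos, hsum =>
      simp only [List.mem_cons, List.sum_cons] at hpos hsum
      have := hpos x (by simp)
      have := hpos y (by simp)
      omega
  rw [this]; simp

theorem Composition.sum_blocks_two {M : Type*} [AddCommMonoid M] (f : List ℕ → M) :
    ∑ c : Composition 2, f c.blocks = f [2] + f [1, 1] := by
  have : (Finset.univ : Finset (Composition 2)) =
      {⟨[2], by simp, rfl⟩, ⟨[1, 1], by simp, rfl⟩} := by
    refine (Finset.eq_univ_iff_forall.2 fun c => ?_).symm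
    have hpos : ∀ i ∈ c.blocks, 0 < i := fun i hi => c.blocks_pos hi
    have hsum := c.blocks_sum
    simp only [Finset.mem_insert, Finset.mem_singleton, Composition.ext_iff]
    generalize c.blocks = l at hpos hsum ⊢
    match l, hpos, hsum with
    | [], _, hsum => simp at hsum
    | [x], _, hsum => simpa using hsum
    | [x, y], hpos, hsum =>
      simp only [List.mem_cons, List.sum_cons, List.sum_nil, List.cons.injEq] at hpos hsum ⊢
      have := hpos x (by simp)
      have := hpos y (by simp)
      grind
    | x :: y :: z :: l, hpos, hsum =>
      simp only [List.mem_cons, List.sum_cons] at hpos hsum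
      have := hpos x (by simp)
      have := hpos y (by simp)
      have := hpos z (by simp)
      omega
  rw [this, Finset.sum_pair (by decide)]

theorem Composition.sum_blocks_three {M : Type*} [AddCommMonoid M] (f : List ℕ → M) :
    ∑ c : Composition 3, f c.blocks = f [3] + (f [2, 1] + (f [1, 2] + f [1, 1, 1])) := by
  have : (Finset.univ : Finset (Composition 3)) =
      {⟨[3], by simp, rfl⟩, ⟨[2, 1], by simp, rfl⟩, ⟨[1, 2], by simp, rfl⟩,
        ⟨[1, 1, 1], by simp, rfl⟩} := by
    refine (Finset.eq_univ_iff_forall.2 fun c => ?_).symm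
    have hpos : ∀ i ∈ c.blocks, 0 < i := fun i hi => c.blocks_pos hi
    have hsum := c.blocks_sum
    simp only [Finset.mem_insert, Finset.mem_singleton, Composition.ext_iff]
    generalize c.blocks = l at hpos hsum ⊢
    match l, hpos, hsum with
    | [], _, hsum => simp at hsum
    | [x], _, hsum => simpa using hsum
    | [x, y], hpos, hsum =>
      simp only [List.mem_cons, List.sum_cons, List.sum_nil, List.cons.injEq] at hpos hsum ⊢
      have := hpos x (by simp)
      have := hpos y (by simp)
      grind
    | [x, y, z], hpos, hsum =>
      simp only [List.mem_cons, List.sum_cons, List.sum_nil, List.cons.injEq] at hpos hsum ⊢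
      have := hpos x (by simp)
      have := hpos y (by simp)
      have := hpos z (by simp)
      grind
    | x :: y :: z :: w :: l, hpos, hsum =>
      simp only [List.mem_cons, List.sum_cons] at hpos hsum
      have := hpos x (by simp)
      have := hpos y (by simp)
      have := hpos z (by simp)
      have := hpos w (by simp)
      omega
  rw [this, Finset.sum_insert (by decide), Finset.sum_insert (by decide),
    Finset.sum_pair (by decide)]

/-! ### Long-time response and comparison of growth rates -/

section Asymptotics

variable {A : Type*} [NormedRing A] [NormedAlgebra ℝ A] [CompleteSpace A]

namespace Relaxes

variable {a Λ S : A}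

/-- Response of a relaxing semigroup to an asymptotically affine source. -/
theorem tendsto_of_affine_source (h : Relaxes a Λ) (haS : a * S = 1 - Λ) (hΛS : Λ * S = 0)
    {f g : ℝ → A} (hf : ∀ t, HasDerivAt f (a * f t + g t) t) (hg : Continuous g) {X Y : A}
    (hgl : Tendsto (fun t : ℝ => g t - t • X) atTop (𝓝 Y)) :
    Tendsto (fun t : ℝ => (1 - Λ) * f t + t • (S * X)) atTop (𝓝 (-(S * Y + S * S * X))) := by
  -- The particular response to the source `t X + Y` is `-(t S X + S Y + S S X)`; after removing it
  -- the source tends to `0`.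
  have hder : ∀ t, HasDerivAt (fun t : ℝ => (1 - Λ) * f t + t • (S * X) + (S * Y + S * S * X))
      (a * ((1 - Λ) * f t + t • (S * X) + (S * Y + S * S * X)) +
        (1 - Λ) * (g t - t • X - Y)) t := by
    intro t
    have h1 := (((hf t).const_mul (1 - Λ)).add ((hasDerivAt_id t).smul_const (S * X))).add_const
      (S * Y + S * S * X)
    refine HasDerivAt.congr_deriv h1 ?_
    have e1 : ∀ Z, a * (S * Z) = Z - Λ * Z := fun Z => by rw [← mul_assoc, haS, sub_mul, one_mul]
    have e2 : ∀ Z, Λ * (S * Z) = 0 := fun Z => by rw [← mul_assoc, hΛS, zero_mul]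
    have e3 : ∀ Z, Λ * (a * Z) = 0 := fun Z => by rw [← mul_assoc, h.mul_gen, zero_mul]
    have e4 : ∀ Z, a * (Λ * Z) = 0 := fun Z => by rw [← mul_assoc, h.gen_mul, zero_mul]
    simp only [mul_add, mul_sub, sub_mul, one_mul, mul_assoc, e1, e2, e3, e4, mul_smul_comm,
      smul_sub, one_smul]
    abel
  have hr : Tendsto (fun t : ℝ => (1 - Λ) * (g t - t • X - Y)) atTop (𝓝 0) := by
    have := (hgl.sub_const Y).const_mul (1 - Λ)
    simpa using this
  have h2 := h.tendsto_zero_of_hasDerivAt hder (by fun_prop) hr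
  have h3 : ∀ t : ℝ, (1 - Λ) * ((1 - Λ) * f t + t • (S * X) + (S * Y + S * S * X)) =
      (1 - Λ) * f t + t • (S * X) + (S * Y + S * S * X) := by
    intro t
    have e2 : ∀ Z, Λ * (S * Z) = 0 := fun Z => by rw [← mul_assoc, hΛS, zero_mul]
    have e3 : ∀ Z, Λ * (Λ * Z) = Λ * Z := fun Z => by rw [← mul_assoc, h.idem]
    simp only [mul_add, mul_sub, sub_mul, one_mul, mul_assoc, e2, e3, mul_smul_comm]
    abel
  simp_rw [h3] at h2
  have := h2.sub_const (S * Y + S * S * X)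
  simpa using this

theorem tendsto_smul_exp_sub (h : Relaxes a Λ) :
    Tendsto (fun t : ℝ => t • (NormedSpace.exp (t • a) - Λ)) atTop (𝓝 0) := by
  obtain ⟨c, γ, hc, hγ, hd⟩ := h.exists_decay
  have h1 := (Real.tendsto_pow_mul_exp_neg_atTop_nhds_zero 1).comp
    (tendsto_id.const_mul_atTop hγ)
  have h2 : Tendsto (fun t : ℝ => t * (c * Real.exp (-(γ * t)))) atTop (𝓝 0) := by
    have h3 := h1.const_mul (c / γ)
    rw [mul_zero] at h3
    refine h3.congr fun t => ?_
    simp only [Function.comp_apply, id, pow_one]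
    field_simp
  refine squeeze_zero_norm' ?_ h2
  filter_upwards [eventually_ge_atTop 0] with t ht
  rw [norm_smul, Real.norm_of_nonneg ht]
  exact mul_le_mul_of_nonneg_left (hd t ht) ht

end Relaxes

/-- Dividing by `t` isolates the slope; once that is zero, the constant is a limit of `f` itself. -/
theorem eq_zero_of_tendsto_of_tendsto_add_smul {f : ℝ → A} {X Y : A}
    (h0 : Tendsto f atTop (𝓝 0)) (h1 : Tendsto (fun t : ℝ => f t + t • X) atTop (𝓝 Y)) :
    X = 0 ∧ Y = 0 := by
  have h2 : Tendsto (fun t : ℝ => t • X) atTop (𝓝 Y) := by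
    have := h1.sub h0
    simpa using this
  have h3 : Tendsto (fun t : ℝ => t⁻¹ • t • X) atTop (𝓝 ((0 : ℝ) • Y)) :=
    tendsto_inv_atTop_zero.smul h2
  have hX : X = 0 := by
    rw [zero_smul] at h3
    refine tendsto_nhds_unique (tendsto_const_nhds.congr' ?_) h3
    filter_upwards [eventually_gt_atTop 0] with t ht
    rw [smul_smul, inv_mul_cancel₀ ht.ne', one_smul]
  refine ⟨hX, ?_⟩
  subst hX
  simp only [smul_zero] at h2
  exact tendsto_nhds_unique h2 tendsto_const_nhds

theorem eq_of_hasDerivAt_of_nonneg {f g f' : ℝ → A} (hf : ∀ t, 0 ≤ t → HasDerivAt f (f' t) t)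
    (hg : ∀ t, 0 ≤ t → HasDerivAt g (f' t) t) (h0 : f 0 = g 0) {t : ℝ} (ht : 0 ≤ t) : f t = g t :=
  eq_of_has_deriv_right_eq (a := 0) (b := t) (fun x hx => (hf x hx.1).hasDerivWithinAt)
    (fun x hx => (hg x hx.1).hasDerivWithinAt)
    (fun x hx => (hf x hx.1).continuousAt.continuousWithinAt)
    (fun x hx => (hg x hx.1).continuousAt.continuousWithinAt) h0 t ⟨ht, le_rfl⟩

end Asymptotics

/-! ### Dyson terms and the coefficients of orders 1, 2 and 3 -/

namespace TCL

variable {E : Type*} [NormedAddCommGroup E] [NormedSpace ℂ E] [CompleteSpace E]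

section Dyson

variable (L₀ L P X : LinOp E)

theorem continuous_interaction : Continuous (interaction L₀ L) :=
  (((continuous_exp_smul L₀).comp continuous_neg).mul continuous_const).mul (continuous_exp_smul L₀)

theorem continuous_dyson (k : ℕ) : Continuous (dyson L₀ L k) := by
  induction k with
  | zero => exact continuous_const
  | succ k ih =>
    exact continuous_iff_continuousAt.2 fun t =>
      (((continuous_interaction L₀ L).mul ih).integral_hasStrictDerivAt 0 t).hasDerivAt.continuousAt

theorem hasDerivAt_dyson (k : ℕ) (t : ℝ) :
    HasDerivAt (dyson L₀ L (k + 1)) (interaction L₀ L t * dyson L₀ L k t) t :=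
  (((continuous_interaction L₀ L).mul (continuous_dyson L₀ L k)).integral_hasStrictDerivAt
    0 t).hasDerivAt

/-- The Dyson terms in the Schrödinger picture. -/
noncomputable def schrodinger (k : ℕ) (t : ℝ) : LinOp E := NormedSpace.exp (t • L₀) * dyson L₀ L k t

theorem schrodinger_zero (t : ℝ) : schrodinger L₀ L 0 t = NormedSpace.exp (t • L₀) := mul_one _

theorem schrodinger_succ_zero (k : ℕ) : schrodinger L₀ L (k + 1) 0 = 0 := by
  simp [schrodinger, dyson]

theorem continuous_schrodinger (k : ℕ) : Continuous (schrodinger L₀ L k) :=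
  (continuous_exp_smul L₀).mul (continuous_dyson L₀ L k)

theorem hasDerivAt_schrodinger_zero (t : ℝ) :
    HasDerivAt (schrodinger L₀ L 0) (L₀ * schrodinger L₀ L 0 t) t := by
  have : schrodinger L₀ L 0 = fun t : ℝ => NormedSpace.exp (t • L₀) := by
    ext1 t; exact schrodinger_zero L₀ L t
  rw [this]
  exact hasDerivAt_exp_smul_const' (𝕂 := ℝ) L₀ t

theorem hasDerivAt_schrodinger (k : ℕ) (t : ℝ) :
    HasDerivAt (schrodinger L₀ L (k + 1))
      (L₀ * schrodinger L₀ L (k + 1) t + L * schrodinger L₀ L k t) t := by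
  refine HasDerivAt.congr_deriv
    ((hasDerivAt_exp_smul_const' (𝕂 := ℝ) L₀ t).mul (hasDerivAt_dyson L₀ L k t)) ?_
  simp only [schrodinger, interaction, ← mul_assoc, exp_smul_mul_exp_neg_smul, one_mul]

variable {L₀ L P}

theorem proj_mul_interaction_mul_dyson
    (hom : ∀ t : ℝ, 0 ≤ t → P * NormedSpace.exp ((-t) • L₀) * L = P * L) (k : ℕ) {t : ℝ}
    (ht : 0 ≤ t) : P * (interaction L₀ L t * dyson L₀ L k t) = P * L * schrodinger L₀ L k t := by
  simp only [schrodinger, interaction, ← mul_assoc, hom t ht]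

theorem deriv_moment
    (hom : ∀ t : ℝ, 0 ≤ t → P * NormedSpace.exp ((-t) • L₀) * L = P * L) (k : ℕ) {t : ℝ}
    (ht : 0 ≤ t) :
    deriv (moment L₀ L P X (k + 1)) t = P * L * schrodinger L₀ L k t * X := by
  rw [← proj_mul_interaction_mul_dyson hom k ht]
  exact (((hasDerivAt_dyson L₀ L k t).const_mul P).mul_const X).deriv

/-- Here and in the next two orders `X` factors out on the right. Taking `X = 1` therefore treats
the homogeneous and inhomogeneous coefficients at once. -/
theorem tclCoeff_one (hom : ∀ t : ℝ, 0 ≤ t → P * NormedSpace.exp ((-t) • L₀) * L = P * L)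
    {t : ℝ} (ht : 0 ≤ t) :
    tclCoeff L₀ L P X 1 t = P * L * schrodinger L₀ L 0 t * X := by
  rw [tclCoeff, Composition.sum_blocks_one (tclTerm L₀ L P X t)]
  exact deriv_moment X hom 0 ht

theorem tclCoeff_two (hom : ∀ t : ℝ, 0 ≤ t → P * NormedSpace.exp ((-t) • L₀) * L = P * L)
    {t : ℝ} (ht : 0 ≤ t) :
    tclCoeff L₀ L P X 2 t = (P * L * schrodinger L₀ L 1 t
      - P * L * schrodinger L₀ L 0 t * P * (P * dyson L₀ L 1 t)) * X := by
  rw [tclCoeff, Composition.sum_blocks_two (tclTerm L₀ L P X t)]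
  simp only [tclTerm, momentProd, deriv_moment _ hom _ ht, moment, List.length_singleton, pow_one]
  noncomm_ring

theorem tclCoeff_three (hom : ∀ t : ℝ, 0 ≤ t → P * NormedSpace.exp ((-t) • L₀) * L = P * L)
    {t : ℝ} (ht : 0 ≤ t) :
    tclCoeff L₀ L P X 3 t = (P * L * schrodinger L₀ L 2 t
      - P * L * schrodinger L₀ L 1 t * P * (P * dyson L₀ L 1 t)
      - P * L * schrodinger L₀ L 0 t * P * (P * dyson L₀ L 2 t)
      + P * L * schrodinger L₀ L 0 t * P * (P * dyson L₀ L 1 t) * P * (P * dyson L₀ L 1 t)) * X := by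
  rw [tclCoeff, Composition.sum_blocks_three (tclTerm L₀ L P X t)]
  simp only [tclTerm, momentProd, deriv_moment _ hom _ ht, moment, List.length_cons, List.length_nil]
  noncomm_ring

end Dyson

/-! ### Limits of the coefficients and the relations they force -/

section Limits

variable {L₀ L P Λ S : LinOp E}

theorem tendsto_schrodinger_zero (h : Relaxes L₀ Λ) :
    Tendsto (schrodinger L₀ L 0) atTop (𝓝 Λ) :=
  Tendsto.congr (fun t => (schrodinger_zero L₀ L t).symm) h

/-- The two spectral parts behave differently: on the range of `1 - Λ` the source `L e^{tL₀}` is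
asymptotically constant and the response converges, while the `Λ` part integrates it and grows
linearly. -/
theorem tendsto_schrodinger_one (h : Relaxes L₀ Λ) (hSa : S * L₀ = 1 - Λ)
    (haS : L₀ * S = 1 - Λ) (hSΛ : S * Λ = 0) (hΛS : Λ * S = 0) :
    Tendsto (fun t : ℝ => schrodinger L₀ L 1 t - t • (Λ * L * Λ)) atTop
      (𝓝 (-(S * L * Λ) - Λ * L * S)) := by
  have h1 := h.tendsto_of_affine_source haS hΛS (hasDerivAt_schrodinger L₀ L 0)
    (continuous_const.mul (continuous_schrodinger L₀ L 0)) (X := 0) (Y := L * Λ) (by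
      simpa using (tendsto_schrodinger_zero h).const_mul L)
  have h2 : ∀ t, Λ * schrodinger L₀ L 1 t =
      t • (Λ * L * Λ) + Λ * L * S * schrodinger L₀ L 0 t - Λ * L * S := by
    intro t
    have hd : ∀ t, HasDerivAt (fun t : ℝ => Λ * schrodinger L₀ L 1 t -
        (t • (Λ * L * Λ) + Λ * L * S * schrodinger L₀ L 0 t)) 0 t := by
      intro t
      refine (((hasDerivAt_schrodinger L₀ L 0 t).const_mul Λ).sub
        (((hasDerivAt_id t).smul_const (Λ * L * Λ)).add
        ((hasDerivAt_schrodinger_zero L₀ L t).const_mul (Λ * L * S)))).congr_deriv ?_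
      rw [mul_add, ← mul_assoc Λ L₀, h.mul_gen, ← mul_assoc (Λ * L * S) L₀, mul_assoc (Λ * L) S L₀,
        hSa, mul_sub, sub_mul, mul_assoc (Λ * L) Λ, schrodinger_zero, h.mul_exp, one_smul]
      noncomm_ring
    have := is_const_of_deriv_eq_zero (fun t => (hd t).differentiableAt) (fun t => (hd t).deriv) t 0
    simp only [schrodinger_succ_zero L₀ L 0, schrodinger_zero, zero_smul, mul_zero, NormedSpace.exp_zero,
      mul_one, zero_add, zero_sub] at this
    rw [schrodinger_zero]
    rw [sub_eq_iff_eq_add] at this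
    rw [this]; abel
  have h3 := (tendsto_schrodinger_zero (L := L) h).const_mul (Λ * L * S)
  rw [mul_assoc (Λ * L) S, hSΛ, mul_zero] at h3
  have h4 := (h1.add h3).sub_const (Λ * L * S)
  refine (h4.congr fun t => ?_).trans_eq (by simp [mul_assoc])
  have := h2 t
  rw [sub_mul, one_mul, this]
  simp; abel

theorem tendsto_proj_schrodinger_one (h : Relaxes L₀ Λ) (hSa : S * L₀ = 1 - Λ)
    (haS : L₀ * S = 1 - Λ) (hSΛ : S * Λ = 0) (hΛS : Λ * S = 0) (h1 : P * L * Λ = 0) :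
    Tendsto (fun t : ℝ => P * L * schrodinger L₀ L 1 t) atTop (𝓝 (-(P * L * S * L * Λ))) := by
  have := (tendsto_schrodinger_one (L := L) h hSa haS hSΛ hΛS).const_mul (P * L)
  refine (this.congr fun t => ?_).trans_eq ?_
  · rw [mul_sub, mul_smul_comm, ← mul_assoc, ← mul_assoc, h1]; simp
  · rw [mul_sub, ← mul_assoc (P * L) (Λ * L), ← mul_assoc (P * L) Λ L, h1]; simp [mul_assoc]

/-- Since `P L Λ = 0`, only the relaxing part contributes. Its source is the affine asymptotics of
the previous Dyson term, so the response is affine as well. -/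
theorem tendsto_proj_schrodinger_two (h : Relaxes L₀ Λ) (hSa : S * L₀ = 1 - Λ)
    (haS : L₀ * S = 1 - Λ) (hSΛ : S * Λ = 0) (hΛS : Λ * S = 0) (h1 : P * L * Λ = 0) :
    Tendsto (fun t : ℝ => P * L * schrodinger L₀ L 2 t + t • (P * L * S * L * Λ * L * Λ)) atTop
      (𝓝 (P * L * S * L * S * L * Λ + P * L * S * L * Λ * L * S
        - P * L * S * S * L * Λ * L * Λ)) := by
  have h2 := (tendsto_schrodinger_one (L := L) h hSa haS hSΛ hΛS).const_mul L
  have h3 := h.tendsto_of_affine_source haS hΛS (hasDerivAt_schrodinger L₀ L 1)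
    (continuous_const.mul (continuous_schrodinger L₀ L 1)) (X := L * (Λ * L * Λ))
    (h2.congr fun t => by rw [mul_sub, mul_smul_comm])
  refine ((h3.const_mul (P * L)).congr fun t => ?_).trans_eq ?_
  · rw [mul_add, mul_smul_comm, ← mul_assoc, mul_sub, h1]
    simp [mul_assoc]
  · congr 1; noncomm_ring

/-- `P L Λ = 0` gives `P L = P L S L₀`, which makes `P L e^{tL₀}` an exact derivative. -/
theorem proj_dyson_one (hom : ∀ t : ℝ, 0 ≤ t → P * NormedSpace.exp ((-t) • L₀) * L = P * L)
    (hSa : S * L₀ = 1 - Λ) (h1 : P * L * Λ = 0) {t : ℝ} (ht : 0 ≤ t) :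
    P * dyson L₀ L 1 t = P * L * S * schrodinger L₀ L 0 t - P * L * S := by
  refine eq_of_hasDerivAt_of_nonneg (f := fun t => P * dyson L₀ L 1 t)
    (g := fun t => P * L * S * schrodinger L₀ L 0 t - P * L * S)
    (f' := fun t => P * L * schrodinger L₀ L 0 t) (fun s hs => ?_) (fun s _ => ?_) ?_ ht
  · rw [← proj_mul_interaction_mul_dyson hom 0 hs]
    exact (hasDerivAt_dyson L₀ L 0 s).const_mul P
  · refine (((hasDerivAt_schrodinger_zero L₀ L s).const_mul _).sub_const _).congr_deriv ?_
    rw [← mul_assoc, mul_assoc (P * L) S, hSa, mul_sub, h1]; simp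
  · simp [schrodinger_zero, dyson]

theorem proj_dyson_two (hom : ∀ t : ℝ, 0 ≤ t → P * NormedSpace.exp ((-t) • L₀) * L = P * L)
    (h : Relaxes L₀ Λ) (hSa : S * L₀ = 1 - Λ) (h1 : P * L * Λ = 0) {t : ℝ} (ht : 0 ≤ t) :
    P * dyson L₀ L 2 t = P * L * S * schrodinger L₀ L 1 t - t • (P * L * S * L * Λ)
      - P * L * S * L * S * schrodinger L₀ L 0 t + P * L * S * L * S := by
  refine eq_of_hasDerivAt_of_nonneg (f := fun t => P * dyson L₀ L 2 t)
    (g := fun t => P * L * S * schrodinger L₀ L 1 t - t • (P * L * S * L * Λ)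
      - P * L * S * L * S * schrodinger L₀ L 0 t + P * L * S * L * S)
    (f' := fun t => P * L * schrodinger L₀ L 1 t) (fun s hs => ?_) (fun s _ => ?_) ?_ ht
  · rw [← proj_mul_interaction_mul_dyson hom 1 hs]
    exact (hasDerivAt_dyson L₀ L 1 s).const_mul P
  · refine ((((hasDerivAt_schrodinger L₀ L 0 s).const_mul _).sub
      ((hasDerivAt_id s).smul_const _)).sub
      ((hasDerivAt_schrodinger_zero L₀ L s).const_mul _)).add_const _ |>.congr_deriv ?_
    rw [mul_add, ← mul_assoc _ L₀, mul_assoc (P * L) S L₀, ← mul_assoc _ L₀,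
      mul_assoc (P * L * S * L) S L₀, hSa, mul_sub, h1, mul_sub, sub_mul _ _ (schrodinger L₀ L 0 s),
      mul_assoc _ Λ (schrodinger L₀ L 0 s), schrodinger_zero, h.mul_exp]
    simp [mul_assoc]
  · simp [schrodinger_zero, schrodinger_succ_zero L₀ L 0, dyson]

theorem tendsto_proj_dyson_one
    (hom : ∀ t : ℝ, 0 ≤ t → P * NormedSpace.exp ((-t) • L₀) * L = P * L)
    (h : Relaxes L₀ Λ) (hSa : S * L₀ = 1 - Λ) (hSΛ : S * Λ = 0) (h1 : P * L * Λ = 0) :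
    Tendsto (fun t : ℝ => P * dyson L₀ L 1 t) atTop (𝓝 (-(P * L * S))) := by
  have := ((tendsto_schrodinger_zero (L := L) h).const_mul (P * L * S)).sub_const (P * L * S)
  rw [mul_assoc (P * L) S Λ, hSΛ, mul_zero, zero_sub] at this
  refine this.congr' ?_
  filter_upwards [eventually_ge_atTop 0] with t ht
  exact (proj_dyson_one hom hSa h1 ht).symm

theorem tendsto_proj_schrodinger_zero (h : Relaxes L₀ Λ) (h1 : P * L * Λ = 0) :
    Tendsto (fun t : ℝ => P * L * schrodinger L₀ L 0 t) atTop (𝓝 0) := by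
  simpa [h1] using (tendsto_schrodinger_zero (L := L) h).const_mul (P * L)

/-- The second Dyson term grows linearly, but the factor in front equals `P L (e^{tL₀} - Λ)` and
decays exponentially. -/
theorem tendsto_proj_schrodinger_zero_mul_dyson_two
    (hom : ∀ t : ℝ, 0 ≤ t → P * NormedSpace.exp ((-t) • L₀) * L = P * L)
    (h : Relaxes L₀ Λ) (hSa : S * L₀ = 1 - Λ)
    (haS : L₀ * S = 1 - Λ) (hSΛ : S * Λ = 0) (hΛS : Λ * S = 0) (h1 : P * L * Λ = 0) :
    Tendsto (fun t : ℝ => P * L * schrodinger L₀ L 0 t * P * (P * dyson L₀ L 2 t)) atTop (𝓝 0) := by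
  have t0 := tendsto_proj_schrodinger_zero (L := L) h h1
  have t1 : Tendsto (fun t : ℝ => P * dyson L₀ L 2 t + t • (P * L * S * L * Λ)) atTop
      (𝓝 (P * L * S * (-(S * L * Λ) - Λ * L * S) - P * L * S * L * S * Λ + P * L * S * L * S)) := by
    refine ((((tendsto_schrodinger_one (L := L) h hSa haS hSΛ hΛS).const_mul (P * L * S)).sub
      ((tendsto_schrodinger_zero (L := L) h).const_mul (P * L * S * L * S))).add_const
        (P * L * S * L * S)).congr' ?_
    filter_upwards [eventually_ge_atTop 0] with t ht
    rw [proj_dyson_two hom h hSa h1 ht, mul_sub, mul_smul_comm, mul_assoc Λ L Λ,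
      ← mul_assoc (P * L * S) Λ, mul_assoc (P * L) S Λ, hSΛ]
    simp; abel
  have t2 := (h.tendsto_smul_exp_sub.const_mul (P * L)).mul_const (P * (P * L * S * L * Λ))
  have t3 := ((t0.mul_const P).mul t1).sub t2
  refine (t3.congr fun t => ?_).trans_eq (by simp)
  rw [schrodinger_zero, mul_smul_comm, mul_sub, h1, mul_add, mul_smul_comm, smul_mul_assoc, sub_zero]
  simp only [mul_assoc]; abel

/-- Limits of the second-order coefficients. -/
theorem tendsto_tclCoeff_two
    (hom : ∀ t : ℝ, 0 ≤ t → P * NormedSpace.exp ((-t) • L₀) * L = P * L)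
    (h : Relaxes L₀ Λ) (hSa : S * L₀ = 1 - Λ)
    (haS : L₀ * S = 1 - Λ) (hSΛ : S * Λ = 0) (hΛS : Λ * S = 0) (h1 : P * L * Λ = 0)
    (X : LinOp E) :
    Tendsto (tclCoeff L₀ L P X 2) atTop (𝓝 (-(P * L * S * L * Λ) * X)) := by
  have := (((tendsto_proj_schrodinger_one h hSa haS hSΛ hΛS h1).sub
    (((tendsto_proj_schrodinger_zero h h1).mul_const P).mul
      (tendsto_proj_dyson_one hom h hSa hSΛ h1))).mul_const X)
  refine (this.congr' ?_).trans_eq (by simp)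
  filter_upwards [eventually_ge_atTop 0] with t ht
  exact (tclCoeff_two X hom ht).symm

theorem tendsto_tclCoeff_three
    (hom : ∀ t : ℝ, 0 ≤ t → P * NormedSpace.exp ((-t) • L₀) * L = P * L)
    (h : Relaxes L₀ Λ) (hSa : S * L₀ = 1 - Λ)
    (haS : L₀ * S = 1 - Λ) (hSΛ : S * Λ = 0) (hΛS : Λ * S = 0) (h1 : P * L * Λ = 0)
    (hP : P * P = P) :
    Tendsto (fun t : ℝ => tclCoeff L₀ L P 1 3 t + t • (P * L * S * L * Λ * L * Λ)) atTop
      (𝓝 (P * L * S * L * S * L * Λ + P * L * S * L * Λ * L * S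
        - P * L * S * S * L * Λ * L * Λ - P * L * S * L * Λ * P * L * S)) := by
  have a0 := tendsto_proj_schrodinger_zero h h1
  have a1 := tendsto_proj_schrodinger_one h hSa haS hSΛ hΛS h1
  have a2 := tendsto_proj_schrodinger_two h hSa haS hSΛ hΛS h1
  have a3 := tendsto_proj_dyson_one hom h hSa hSΛ h1
  have a4 := tendsto_proj_schrodinger_zero_mul_dyson_two hom h hSa haS hSΛ hΛS h1
  have := ((a2.sub ((a1.mul_const P).mul a3)).sub a4).add
    ((((a0.mul_const P).mul a3).mul_const P).mul a3)
  refine (this.congr' ?_).trans_eq ?_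
  · filter_upwards [eventually_ge_atTop 0] with t ht
    rw [tclCoeff_three 1 hom ht, mul_one]
    abel
  · have : P * L * S * L * Λ * P * (P * L * S) = P * L * S * L * Λ * P * L * S := by
      simp only [← mul_assoc]; rw [mul_assoc _ P P, hP]
    simp [this]

/-- What the vanishing of the first- and third-order coefficients means. -/
theorem third_order_relations
    (hom : ∀ t : ℝ, 0 ≤ t → P * NormedSpace.exp ((-t) • L₀) * L = P * L)
    (h : Relaxes L₀ Λ) (hSa : S * L₀ = 1 - Λ)
    (haS : L₀ * S = 1 - Λ) (hSΛ : S * Λ = 0) (hΛS : Λ * S = 0) (h1 : P * L * Λ = 0)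
    (hP : P * P = P) (hT : Tendsto (tclCoeff L₀ L P 1 3) atTop (𝓝 0)) :
    P * L * S * L * Λ * L = P * L * S * L * Λ * P * L ∧
      P * L * S * L * S * L * Λ = P * L * S * S * L * Λ * L * Λ := by
  obtain ⟨hX, hY⟩ := eq_zero_of_tendsto_of_tendsto_add_smul hT
    (tendsto_tclCoeff_three hom h hSa haS hSΛ hΛS h1 hP)
  -- Right multiplication by `Λ` removes the terms ending in `S`; multiplying what is left by `L₀`
  -- then turns that final `S` into `1 - Λ`, whose `Λ` part vanishes by `hX` and `h1`.
  have hYΛ := congrArg (· * Λ) hY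
  simp only [add_mul, sub_mul, zero_mul] at hYΛ
  rw [mul_assoc _ S Λ, mul_assoc _ S Λ, hSΛ, mul_assoc _ Λ Λ, mul_assoc _ Λ Λ, h.idem] at hYΛ
  have e2 : P * L * S * L * S * L * Λ = P * L * S * S * L * Λ * L * Λ := by
    simpa [sub_eq_zero] using hYΛ
  refine ⟨?_, e2⟩
  rw [e2] at hY
  have e3 : P * L * S * L * Λ * L * S = P * L * S * L * Λ * P * L * S := by
    rw [← sub_eq_zero, ← hY]; abel
  have e4 : P * L * S * L * Λ * L * S * L₀ = P * L * S * L * Λ * P * L * S * L₀ := by rw [e3]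
  rw [mul_assoc _ S L₀, mul_assoc _ S L₀, hSa, mul_sub, mul_sub, hX, mul_one, mul_one,
    mul_assoc (_ * P) L Λ, mul_assoc _ P (L * Λ), ← mul_assoc P L Λ, h1] at e4
  simpa using e4

end Limits

end TCL

/-! ### Uniform bounds for GKSL semigroups -/

/-- A semigroup whose generator satisfies `‖1 + δ a‖ ≤ 1 + O(δ²)` is contractive. -/
theorem norm_exp_smul_le_one {A : Type*} [NormedRing A] [NormedAlgebra ℝ A] [CompleteSpace A]
    {a : A} {c : ℝ} (h : ∀ δ : ℝ, 0 ≤ δ → ‖1 + δ • a‖ ≤ 1 + c * δ ^ 2) {t : ℝ} (ht : 0 ≤ t) :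
    ‖NormedSpace.exp (t • a)‖ ≤ 1 := by
  let _ : NormedAlgebra ℚ A := NormedAlgebra.restrictScalars ℚ ℝ A
  have key : ∀ η : ℝ, 0 < η → ‖NormedSpace.exp (t • a)‖ ≤ Real.exp (2 * η * t) := by
    intro η hη
    have h0 := (hasDerivAt_iff_isLittleO.1 (hasDerivAt_exp_smul_const (𝕂 := ℝ) a 0)).def hη
    have hcη : ∀ᶠ δ in 𝓝 (0 : ℝ), c * δ < η :=
      (continuous_const.mul continuous_id).tendsto' (0 : ℝ) 0 (by simp) |>.eventually
        (gt_mem_nhds hη)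
    have hlim : Tendsto (fun m : ℕ => t / m) atTop (𝓝 0) := tendsto_const_div_atTop_nhds_zero_nat t
    -- Time is cut into `m` steps so short that both the Taylor error of the exponential and `c δ²`
    -- are at most `η δ`; each step then has norm at most `1 + 2 η δ`.
    obtain ⟨m, ⟨hm1, hm2⟩, hm⟩ :=
      ((hlim.eventually (h0.and hcη)).and (eventually_gt_atTop 0)).exists
    have hm' : (0 : ℝ) < m := by exact_mod_cast hm
    set δ := t / m with hδ
    have hδ0 : 0 ≤ δ := by positivity
    simp only [zero_smul, NormedSpace.exp_zero, one_mul, sub_zero, Real.norm_eq_abs,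
      abs_of_nonneg hδ0] at hm1
    have h1 : ‖NormedSpace.exp (δ • a)‖ ≤ Real.exp (2 * η * δ) := by
      have e : NormedSpace.exp (δ • a) = (NormedSpace.exp (δ • a) - 1 - δ • a) + (1 + δ • a) := by
        abel
      rw [e]
      refine (norm_add_le_of_le hm1 (h δ hδ0)).trans ?_
      have := Real.add_one_le_exp (2 * η * δ)
      nlinarith
    have h2 : t • a = m • (δ • a) := by
      rw [← Nat.cast_smul_eq_nsmul ℝ, smul_smul, hδ, mul_div_cancel₀ _ hm'.ne']
    have h3 : 2 * η * t = m * (2 * η * δ) := by rw [hδ]; field_simp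
    rw [h2, NormedSpace.exp_nsmul, h3, Real.exp_nat_mul]
    exact (norm_pow_le' _ hm).trans (pow_le_pow_left₀ (norm_nonneg _) h1 m)
  have hlim : Tendsto (fun η : ℝ => Real.exp (2 * η * t)) (𝓝[>] 0) (𝓝 1) := by
    have : Continuous fun η : ℝ => Real.exp (2 * η * t) := by fun_prop
    exact (this.tendsto' 0 1 (by simp)).mono_left nhdsWithin_le_nhds
  exact ge_of_tendsto hlim (eventually_nhdsWithin_of_forall fun η hη => key η hη)

namespace Matrix

variable {n : Type*} [Fintype n] [DecidableEq n]

theorem l2_opNorm_one_le : ‖(1 : Matrix n n ℂ)‖ ≤ 1 := by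
  have h := l2_opNorm_conjTranspose_mul_self (1 : Matrix n n ℂ)
  rw [conjTranspose_one, one_mul] at h
  nlinarith [norm_nonneg (1 : Matrix n n ℂ)]

/-- Amplification `A ↦ A ⊗ 1` is a star homomorphism of C⋆-algebras, hence contractive. -/
theorem l2_opNorm_blockDiagonal_const_le {ι : Type*} [Fintype ι] [DecidableEq ι]
    (A : Matrix n n ℂ) : ‖blockDiagonal fun _ : ι => A‖ ≤ ‖A‖ := by
  let φ : Matrix n n ℂ →⋆ₙₐ[ℂ] Matrix (n × ι) (n × ι) ℂ :=
    { toFun := fun A => blockDiagonal fun _ : ι => A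
      map_smul' := fun c A => blockDiagonal_smul c fun _ : ι => A
      map_zero' := blockDiagonal_zero
      map_add' := fun A B => blockDiagonal_add (fun _ : ι => A) fun _ => B
      map_mul' := fun A B => blockDiagonal_mul (fun _ : ι => A) fun _ => B
      map_star' := fun A => (blockDiagonal_conjTranspose fun _ : ι => A).symm }
  exact NonUnitalStarAlgHom.norm_apply_le φ A

/-- The norm of a completely positive map is attained at the identity. -/
theorem l2_opNorm_sum_conjTranspose_mul_mul_le {ι : Type*} [Fintype ι] [DecidableEq ι]
    (W : ι → Matrix n n ℂ) (A : Matrix n n ℂ) :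
    ‖∑ j, (W j).conjTranspose * A * W j‖ ≤ ‖A‖ * ‖∑ j, (W j).conjTranspose * W j‖ := by
  -- Stacking the `W j` into one column `R` gives the Stinespring form `R† (A ⊗ 1) R`, and `‖R‖² =
  -- ‖R† R‖`.
  let R : Matrix (n × ι) n ℂ := of fun x k => W x.2 x.1 k
  have h1 : ∀ B : Matrix n n ℂ, R.conjTranspose * ((blockDiagonal fun _ : ι => B) * R) =
      ∑ j, (W j).conjTranspose * B * W j := by
    intro B
    ext i k
    simp only [mul_apply, R, Fintype.sum_prod_type, blockDiagonal_apply, of_apply,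
      conjTranspose_apply, sum_apply, ite_mul, zero_mul, Finset.sum_ite_eq, Finset.mem_univ,
      if_true]
    rw [Finset.sum_comm]
    refine Finset.sum_congr rfl fun j _ => ?_
    simp only [Finset.mul_sum, Finset.sum_mul]
    rw [Finset.sum_comm]
    refine Finset.sum_congr rfl fun x _ => Finset.sum_congr rfl fun y _ => ?_
    ring
  have h2 : R.conjTranspose * R = ∑ j, (W j).conjTranspose * W j := by
    have := h1 1
    rw [show (blockDiagonal fun _ : ι => (1 : Matrix n n ℂ)) = 1 from blockDiagonal_one] at this
    simpa using this
  rw [← h1 A, ← h2, l2_opNorm_conjTranspose_mul_self]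
  calc _ ≤ ‖R.conjTranspose‖ * (‖blockDiagonal fun _ : ι => A‖ * ‖R‖) :=
        (l2_opNorm_mul _ _).trans (mul_le_mul_of_nonneg_left (l2_opNorm_mul _ _) (norm_nonneg _))
    _ ≤ ‖R‖ * (‖A‖ * ‖R‖) := by
        rw [l2_opNorm_conjTranspose]
        gcongr
        exact l2_opNorm_blockDiagonal_const_le A
    _ = _ := by ring

end Matrix

namespace TCL

open Matrix

variable {n : Type*} [Fintype n] [DecidableEq n]

/-- `A ↦ K† A + A K + ∑ⱼ Vⱼ† A Vⱼ`. -/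
noncomputable def heisenberg {m : ℕ} (K : Matrix n n ℂ) (V : Fin m → Matrix n n ℂ) : SuperOp n :=
  ContinuousLinearMap.mul ℂ _ K.conjTranspose + (ContinuousLinearMap.mul ℂ _).flip K +
    ∑ j, (ContinuousLinearMap.mul ℂ _ (V j).conjTranspose) * ((ContinuousLinearMap.mul ℂ _).flip (V j))

theorem heisenberg_apply {m : ℕ} (K : Matrix n n ℂ) (V : Fin m → Matrix n n ℂ)
    (A : Matrix n n ℂ) : heisenberg K V A =
      K.conjTranspose * A + A * K + ∑ j, (V j).conjTranspose * A * V j := by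
  simp [heisenberg, mul_assoc]

/-- To first order in `δ`, `1 + δ G` is completely positive with Kraus operators `1 + δ K` and `√δ
Vⱼ`. The hypothesis makes its value at the identity `1 + O(δ²)`, and that value controls the norm.
-/
theorem norm_exp_heisenberg_le_one {m : ℕ} {K : Matrix n n ℂ} {V : Fin m → Matrix n n ℂ}
    (hKV : K.conjTranspose + K + ∑ j, (V j).conjTranspose * V j = 0) {t : ℝ} (ht : 0 ≤ t) :
    ‖NormedSpace.exp (t • heisenberg K V)‖ ≤ 1 := by
  refine norm_exp_smul_le_one (A := SuperOp n) (a := heisenberg K V) (c := 2 * ‖K.conjTranspose * K‖) (fun δ hδ => ?_) ht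
  refine ContinuousLinearMap.opNorm_le_bound _ (by positivity) fun A => ?_
  let W : Option (Fin m) → Matrix n n ℂ := fun o => o.elim (1 + δ • K) fun j => √δ • V j
  have hW : ∀ B, ∑ o, (W o).conjTranspose * B * W o =
      (B + δ • heisenberg K V B) + δ ^ 2 • (K.conjTranspose * B * K) := by
    intro B
    rw [Fintype.sum_option, heisenberg_apply]
    simp only [W, Option.elim, conjTranspose_add, conjTranspose_one, conjTranspose_smul, star_trivial,
      smul_mul_assoc, mul_smul_comm, smul_smul, Real.mul_self_sqrt hδ, ← Finset.smul_sum, smul_add,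
      add_mul, mul_add, one_mul, mul_one]
    rw [sq]; abel
  have h1 : ∑ o, (W o).conjTranspose * W o = 1 + δ ^ 2 • (K.conjTranspose * K) := by
    have := hW 1
    rw [heisenberg_apply] at this
    simpa [hKV] using this
  have h2 : (1 + δ • heisenberg K V) A =
      ∑ o, (W o).conjTranspose * A * W o - δ ^ 2 • (K.conjTranspose * A * K) := by
    rw [hW A]; simp
  rw [h2]
  have h3 : ‖∑ o, (W o).conjTranspose * A * W o‖ ≤ ‖A‖ * (1 + δ ^ 2 * ‖K.conjTranspose * K‖) := by
    refine (l2_opNorm_sum_conjTranspose_mul_mul_le W A).trans ?_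
    rw [h1]
    refine mul_le_mul_of_nonneg_left (norm_add_le_of_le l2_opNorm_one_le ?_) (norm_nonneg _)
    rw [norm_smul, Real.norm_of_nonneg (sq_nonneg δ)]
  have h4 : ‖δ ^ 2 • (K.conjTranspose * A * K)‖ ≤ δ ^ 2 * (‖K.conjTranspose * K‖ * ‖A‖) := by
    rw [norm_smul, Real.norm_of_nonneg (sq_nonneg δ), l2_opNorm_conjTranspose_mul_self]
    gcongr
    calc _ ≤ ‖K.conjTranspose‖ * ‖A‖ * ‖K‖ :=
          (norm_mul_le _ _).trans (mul_le_mul_of_nonneg_right (norm_mul_le _ _) (norm_nonneg _))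
      _ = _ := by rw [l2_opNorm_conjTranspose]; ring
  calc _ ≤ _ := norm_sub_le_of_le h3 h4
    _ = _ := by ring

/-- The trace as a continuous linear functional. -/
noncomputable def traceL (n : Type*) [Fintype n] [DecidableEq n] : Matrix n n ℂ →L[ℂ] ℂ :=
  (traceLinearMap n ℂ ℂ).toContinuousLinearMap

/-- The pairing of the dual flow over time `t - s` with the flow over time `s` is constant in `s`.
-/
theorem trace_exp_duality {G G' : SuperOp n}
    (h : ∀ A ρ, (G' A * ρ).trace = (A * G ρ).trace) (t : ℝ) (A ρ : Matrix n n ℂ) :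
    (NormedSpace.exp (t • G') A * ρ).trace = (A * NormedSpace.exp (t • G) ρ).trace := by
  have hd : ∀ s : ℝ, HasDerivAt (fun s : ℝ => traceL n
      (NormedSpace.exp ((t - s) • G') A * NormedSpace.exp (s • G) ρ)) 0 s := by
    intro s
    have d1 := ((ContinuousLinearMap.apply ℂ (Matrix n n ℂ) A).restrictScalars ℝ).hasFDerivAt
      |>.comp_hasDerivAt s ((hasDerivAt_exp_smul_const' (𝕂 := ℝ) G' (t - s)).scomp s
      ((hasDerivAt_id s).const_sub t))
    have d2 := ((ContinuousLinearMap.apply ℂ (Matrix n n ℂ) ρ).restrictScalars ℝ).hasFDerivAt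
      |>.comp_hasDerivAt s (hasDerivAt_exp_smul_const' (𝕂 := ℝ) G s)
    have d3 := ((traceL n).restrictScalars ℝ).hasFDerivAt.comp_hasDerivAt s (d1.mul d2)
    refine HasDerivAt.congr_deriv d3 ?_
    have := h (NormedSpace.exp ((t - s) • G') A) (NormedSpace.exp (s • G) ρ)
    simp [traceL, this]
  have := is_const_of_deriv_eq_zero (fun s => (hd s).differentiableAt) (fun s => (hd s).deriv) 0 t
  simpa [traceL] using this

theorem IsGKSL.exists_dual {G : SuperOp n} (hG : IsGKSL G) :
    ∃ G' : SuperOp n, (∀ A ρ, (G' A * ρ).trace = (A * G ρ).trace) ∧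
      ∀ t : ℝ, 0 ≤ t → ‖NormedSpace.exp (t • G')‖ ≤ 1 := by
  obtain ⟨H, m, V, hH, hG⟩ := hG
  set Y := ∑ j, (V j).conjTranspose * V j with hY
  set K := (-Complex.I) • H - (1 / 2 : ℂ) • Y with hK
  have hYs : Y.conjTranspose = Y := by
    simp [hY, conjTranspose_sum, conjTranspose_mul]
  have hKs : K.conjTranspose = Complex.I • H - (1 / 2 : ℂ) • Y := by
    simp [hK, conjTranspose_sub, conjTranspose_smul, hYs, hH.eq]
  refine ⟨heisenberg K V, fun A ρ => ?_, fun t ht => norm_exp_heisenberg_le_one ?_ ht⟩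
  · have hGK : G ρ = K * ρ + ρ * K.conjTranspose + ∑ j, V j * ρ * (V j).conjTranspose := by
      rw [hG, hKs, hK, Finset.sum_sub_distrib, ← Finset.smul_sum, Finset.sum_add_distrib,
        ← Finset.sum_mul, ← Finset.mul_sum]
      simp only [sub_mul, mul_sub, smul_mul_assoc, mul_smul_comm, smul_add, smul_sub, neg_smul, neg_mul, ← hY]
      abel
    rw [hGK, heisenberg_apply]
    simp only [add_mul, mul_add, Finset.sum_mul, Finset.mul_sum, trace_add, trace_sum]
    rw [add_comm (K.conjTranspose * A * ρ).trace]
    congr 1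
    · congr 1
      · rw [mul_assoc]
      · rw [mul_assoc, trace_mul_comm, mul_assoc]
    · refine Finset.sum_congr rfl fun j _ => ?_
      rw [mul_assoc, mul_assoc, trace_mul_comm]
      simp only [mul_assoc]
  · rw [hKs, hK]
    have : (1 / 2 : ℂ) • Y + (1 / 2 : ℂ) • Y = Y := by rw [← add_smul]; norm_num
    generalize (1 / 2 : ℂ) • Y = Z at this ⊢
    rw [neg_smul, ← hY, ← this]
    abel

/-- Semigroups with GKSL generators are uniformly bounded. -/
theorem exists_norm_exp_le_of_isGKSL (n : Type*) [Fintype n] [DecidableEq n] :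
    ∃ B : ℝ, 0 ≤ B ∧ ∀ G : SuperOp n, IsGKSL G → ∀ t : ℝ, 0 ≤ t →
      ‖NormedSpace.exp (t • G)‖ ≤ B := by
  -- Each matrix entry of the evolved state is a trace against a matrix unit. Duality moves the
  -- evolution onto that unit, where it is contractive, so the bound depends on `n` alone.
  refine ⟨∑ i : n, ∑ j : n, ‖traceL n‖ * ‖single j i (1 : ℂ)‖ * ‖single i j (1 : ℂ)‖,
    by positivity, fun G hG t ht => ?_⟩
  obtain ⟨G', hdual, hG'⟩ := hG.exists_dual
  refine ContinuousLinearMap.opNorm_le_bound _ (by positivity) fun ρ => ?_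
  set x := NormedSpace.exp (t • G) ρ with hx
  have hentry : ∀ i j, ‖x i j‖ ≤ ‖traceL n‖ * (‖single j i (1 : ℂ)‖ * ‖ρ‖) := by
    intro i j
    have e : x i j = traceL n (NormedSpace.exp (t • G') (single j i 1) * ρ) := by
      have := trace_exp_duality hdual t (single j i 1) ρ
      simp only [traceL, LinearMap.coe_toContinuousLinearMap', traceLinearMap_apply]
      rw [this, ← hx, trace_single_mul]; simp
    rw [e]
    refine (ContinuousLinearMap.le_opNorm _ _).trans
      (mul_le_mul_of_nonneg_left ((norm_mul_le _ _).trans ?_) (norm_nonneg _))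
    refine mul_le_mul_of_nonneg_right ((ContinuousLinearMap.le_opNorm _ _).trans ?_) (norm_nonneg _)
    exact mul_le_of_le_one_left (norm_nonneg _) (hG' t ht)
  rw [matrix_eq_sum_single x, Finset.sum_mul]
  refine norm_sum_le_of_le _ fun i _ => ?_
  rw [Finset.sum_mul]
  refine norm_sum_le_of_le _ fun j _ => ?_
  have : single i j (x i j) = x i j • single i j (1 : ℂ) := by simp [smul_single]
  rw [this, norm_smul]
  calc _ ≤ _ := mul_le_mul_of_nonneg_right (hentry i j) (norm_nonneg _)
    _ = _ := by ring

end TCL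

/-! ### From the hypotheses of the theorem to the operator estimate -/

theorem Real.exp_neg_mul_le_of_rpow_neg_le {γ ε : ℝ} (hγ : 0 < γ) (hε : 0 < ε) {x t : ℝ}
    (hx : 0 < x) (ht : x ^ (-ε) ≤ t) :
    Real.exp (-(γ * t)) ≤ (ε⁻¹ / γ) ^ ε⁻¹ * x := by
  set y := x ^ (-ε) with hy
  have hy0 : 0 < y := Real.rpow_pos_of_pos hx _
  have hp : 0 < ε⁻¹ := inv_pos.2 hε
  have hyx : y ^ ε⁻¹ = x⁻¹ := by
    rw [hy, ← Real.rpow_mul hx.le, neg_mul, mul_inv_cancel₀ hε.ne', Real.rpow_neg_one]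
  -- The inequality `u ≤ e^u` at `u = γ y ε`, raised to the power `1 / ε`, produces the constant.
  have h1 : γ * y * ε ≤ Real.exp (γ * y * ε) := by
    linarith [Real.add_one_le_exp (γ * y * ε)]
  have h2 : y ≤ ε⁻¹ / γ * Real.exp (γ * y * ε) := by
    have : y = ε⁻¹ / γ * (γ * y * ε) := by field_simp
    nth_rewrite 1 [this]
    gcongr
  have h3 : x⁻¹ ≤ (ε⁻¹ / γ) ^ ε⁻¹ * Real.exp (γ * y) := by
    rw [← hyx]
    refine (Real.rpow_le_rpow hy0.le h2 hp.le).trans_eq ?_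
    rw [Real.mul_rpow (by positivity) (Real.exp_pos _).le, ← Real.exp_mul]
    congr 2; field_simp
  have h4 : Real.exp (-(γ * t)) ≤ Real.exp (-(γ * y)) := by
    rw [Real.exp_le_exp]; nlinarith
  refine h4.trans ?_
  have h5 := mul_le_mul_of_nonneg_right h3 (mul_pos hx (Real.exp_pos (-(γ * y)))).le
  have h6 : Real.exp (γ * y) * Real.exp (-(γ * y)) = 1 := by rw [← Real.exp_add]; simp
  calc Real.exp (-(γ * y)) = x⁻¹ * (x * Real.exp (-(γ * y))) := by field_simp
    _ ≤ _ := h5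
    _ = (ε⁻¹ / γ) ^ ε⁻¹ * x * (Real.exp (γ * y) * Real.exp (-(γ * y))) := by ring
    _ = _ := by rw [h6, mul_one]

namespace TCL

variable {E : Type*} [NormedAddCommGroup E] [NormedSpace ℂ E] [CompleteSpace E]
  {L₀ L P Λ S : LinOp E}

/-- The conditions for `P` and `1 - P` add up to one without a right factor, and the invertible
`e^{L₀t}` can then be cancelled on the right. -/
theorem proj_mul_exp_neg_mul (h1 : CanOmit L₀ L P P 1) (h2 : CanOmit L₀ L P (1 - P) 1) (t : ℝ)
    (ht : 0 ≤ t) : P * NormedSpace.exp ((-t) • L₀) * L = P * L := by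
  let τ : ℕ → ℝ := fun j => if j = 0 then 0 else t
  have hτ : Monotone τ := by
    intro i j hij
    simp only [τ]
    split_ifs with hi hj hj
    · exact le_rfl
    · exact ht
    · omega
    · exact le_rfl
  have e1 := h1 1 le_rfl le_rfl τ hτ (by simp [τ])
  have e2 := h2 1 le_rfl le_rfl τ hτ (by simp [τ])
  simp only [word, τ, mul_one, zero_add, one_ne_zero, if_true, if_false, sub_zero] at e1 e2
  have e3 : P * NormedSpace.exp ((-t) • L₀) * (L * NormedSpace.exp (t • L₀)) =
      P * (L * NormedSpace.exp (t • L₀)) := by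
    rw [mul_sub, mul_sub, e1, mul_one, mul_one] at e2
    exact sub_left_injective e2
  have e4 := congrArg (· * NormedSpace.exp ((-t) • L₀)) e3
  simpa only [mul_assoc, exp_smul_mul_exp_neg_smul L₀ t, mul_one] using e4

theorem proj_mul_mul_limit_eq_zero
    (hom : ∀ t : ℝ, 0 ≤ t → P * NormedSpace.exp ((-t) • L₀) * L = P * L) (h : Relaxes L₀ Λ)
    (hK₁ : Tendsto (Kcoeff L₀ L P 1) atTop (𝓝 0))
    (hI₁ : Tendsto (Icoeff L₀ L P 1) atTop (𝓝 0)) : P * L * Λ = 0 := by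
  have h1 := (tendsto_schrodinger_zero (L := L) h).const_mul (P * L)
  refine tendsto_nhds_unique h1 ((hK₁.add hI₁).congr' ?_ |>.trans_eq (by rw [add_zero]))
  filter_upwards [eventually_ge_atTop 0] with t ht
  rw [Kcoeff, Icoeff, tclCoeff_one P hom ht, tclCoeff_one (1 - P) hom ht]
  noncomm_ring

theorem tendsto_tclCoeff_three_zero
    (hom : ∀ t : ℝ, 0 ≤ t → P * NormedSpace.exp ((-t) • L₀) * L = P * L)
    (hK₃ : Tendsto (Kcoeff L₀ L P 3) atTop (𝓝 0))
    (hI₃ : Tendsto (Icoeff L₀ L P 3) atTop (𝓝 0)) :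
    Tendsto (tclCoeff L₀ L P 1 3) atTop (𝓝 0) := by
  refine (hK₃.add hI₃).congr' ?_ |>.trans_eq (by rw [add_zero])
  filter_upwards [eventually_ge_atTop 0] with t ht
  rw [Kcoeff, Icoeff, tclCoeff_three P hom ht, tclCoeff_three (1 - P) hom ht,
    tclCoeff_three 1 hom ht, ← mul_add, add_sub_cancel]

/-- The second-order generator in terms of a solution of `[L₀, X] + Z = L`. -/
theorem second_order_eq (h : Relaxes L₀ Λ) (hSa : S * L₀ = 1 - Λ) (hSΛ : S * Λ = 0)
    (h1 : P * L * Λ = 0) {X Z : LinOp E} (hL : L = (L₀ * X - X * L₀) + Z)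
    (hZ : L₀ * Z = Z * L₀) (Y : LinOp E) :
    -(P * L * S * L * Λ) * Y =
      P * L * (Λ * X - X * Λ) * Y - P * L * Λ * P * X * (1 - Λ) * Y := by
  have hZΛ : Z * Λ = Λ * Z := by
    have hc : ∀ t : ℝ, Z * NormedSpace.exp (t • L₀) = NormedSpace.exp (t • L₀) * Z := fun t =>
      ((show Commute Z L₀ from hZ.symm).smul_right t).exp_right.eq
    exact tendsto_nhds_unique (Tendsto.const_mul Z h)
      ((Tendsto.mul_const Z h).congr fun t => (hc t).symm)
  -- `S` inverts the commutator up to `1 - Λ`, and `Z`, commuting with `Λ`, drops out because `S Λ =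
  -- 0`. With `P L Λ = 0` both sides of the claim become `-P L X Λ Y`.
  have e1 : S * L * Λ = (1 - Λ) * X * Λ := by
    rw [hL, mul_add, add_mul, mul_assoc S Z, hZΛ, ← mul_assoc S Λ, hSΛ, mul_sub, sub_mul,
      ← mul_assoc S L₀, hSa, mul_assoc S (X * L₀), mul_assoc X, h.gen_mul]
    simp
  have e2 : P * L * S * L * Λ = P * L * X * Λ := by
    rw [mul_assoc (P * L) S L, mul_assoc (P * L), e1, ← mul_assoc, ← mul_assoc, mul_sub, h1]
    simp
  rw [e2, mul_sub, ← mul_assoc (P * L) Λ, h1]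
  simp [mul_assoc]

theorem IsSolution.eq_exp {lam : ℝ} {ρ : ℝ → E} (hρ : IsSolution L₀ L lam ρ) {t : ℝ} (ht : 0 ≤ t) :
    ρ t = (NormedSpace.exp ((-t) • L₀) * NormedSpace.exp (t • (L₀ + lam • L))) (ρ 0) := by
  set G := L₀ + lam • L with hG
  -- Undoing the perturbed evolution: `W s (ρ s)` is constant, which gives uniqueness of the
  -- solution with its formula.
  let W : ℝ → LinOp E := fun s => NormedSpace.exp ((-s) • G) * NormedSpace.exp (s • L₀)
  have hW : ∀ s, HasDerivAt W (-(NormedSpace.exp ((-s) • G) * (lam • L) * NormedSpace.exp (s • L₀))) s := by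
    intro s
    have d := ((hasDerivAt_exp_smul_const (𝕂 := ℝ) G (-s)).scomp s (hasDerivAt_neg s)).mul
      (hasDerivAt_exp_smul_const' (𝕂 := ℝ) L₀ s)
    refine HasDerivAt.congr_deriv d ?_
    simp only [Function.comp_apply, neg_smul, one_smul, hG]
    noncomm_ring
  have hd : ∀ s, 0 ≤ s → HasDerivWithinAt (fun s => W s (ρ s)) 0 (Set.Ici 0) s := by
    intro s hs
    have d1 := (ContinuousLinearMap.restrictScalarsL ℂ E E ℝ ℝ).hasFDerivAt.comp_hasDerivAt s (hW s)
    have d2 := d1.hasDerivWithinAt.clm_apply (hρ s hs)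
    refine HasDerivWithinAt.congr_deriv d2 ?_
    have e : W s * (lam • interaction L₀ L s) =
        NormedSpace.exp ((-s) • G) * (lam • L) * NormedSpace.exp (s • L₀) := by
      simp only [W, interaction, mul_smul_comm, smul_mul_assoc, mul_assoc]
      rw [← mul_assoc (NormedSpace.exp (s • L₀)), exp_smul_mul_exp_neg_smul L₀ s, one_mul]
    change -((NormedSpace.exp ((-s) • G) * (lam • L) * NormedSpace.exp (s • L₀)) (ρ s)) +
      (W s * (lam • interaction L₀ L s)) (ρ s) = 0
    rw [e, neg_add_cancel]
  have hconst := constant_of_has_deriv_right_zero (a := 0) (b := t) (f := fun s => W s (ρ s))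
    (fun s hs => ((hd s hs.1).continuousWithinAt).mono Set.Icc_subset_Ici_self)
    (fun s hs => (hd s hs.1).mono (Set.Ici_subset_Ici.2 hs.1)) t ⟨ht, le_rfl⟩
  have h0 : W 0 = 1 := by simp [W]
  simp only [h0, one_apply_eq_self] at hconst
  rw [← hconst, ← mul_apply_eq_comp]
  have : NormedSpace.exp ((-t) • L₀) * NormedSpace.exp (t • G) * W t = 1 := by
    simp only [W]
    rw [mul_assoc, ← mul_assoc (NormedSpace.exp (t • G)), exp_smul_mul_exp_neg_smul G t, one_mul,
      exp_neg_smul_mul_exp_smul L₀ t]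
  rw [this]; rfl

end TCL

/-! ### The main theorem -/

theorem mainTheorem6 {n : Type*} [Fintype n] [DecidableEq n]
    (L₀ L P Λ : SuperOp n)
    (hL₀ : TCL.IsGKSL L₀) (hL : TCL.IsGKSL L) (hP : P * P = P)
    (hrelax : ∀ K : ℕ, TCL.EnhancedRelaxationConditions L₀ L P Λ K)
    (hK₁ : Tendsto (TCL.Kcoeff L₀ L P 1) atTop (𝓝 0))
    (hI₁ : Tendsto (TCL.Icoeff L₀ L P 1) atTop (𝓝 0))
    (hK₃ : Tendsto (TCL.Kcoeff L₀ L P 3) atTop (𝓝 0))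
    (hI₃ : Tendsto (TCL.Icoeff L₀ L P 3) atTop (𝓝 0)) :
    ∃ K₂ I₂ S : SuperOp n,
      -- `K₂` and `I₂` are the limits of the second-order coefficients
      Tendsto (TCL.Kcoeff L₀ L P 2) atTop (𝓝 K₂) ∧
      Tendsto (TCL.Icoeff L₀ L P 2) atTop (𝓝 I₂) ∧
      -- they are given by the algebraic formulae, with `X` in the role of `[𝓛₀, ·]^{(-1)} 𝓛`
      (∀ X Z : SuperOp n, L = (L₀ * X - X * L₀) + Z → L₀ * Z = Z * L₀ →
        K₂ = P * L * (Λ * X - X * Λ) * P - P * L * Λ * P * X * (1 - Λ) * P ∧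
        I₂ = P * L * (Λ * X - X * Λ) * (1 - P) - P * L * Λ * P * X * (1 - Λ) * (1 - P)) ∧
      -- `S` is the pseudoinverse of `𝓛₀`, and there is only one
      TCL.IsPseudoinverse L₀ (1 - Λ) S ∧
      (∀ S' : SuperOp n, TCL.IsPseudoinverse L₀ (1 - Λ) S' → S' = S) ∧
      -- the asymptotics on the time scale `λ⁻²`
      ∀ (ρ₀ : Matrix n n ℂ) (b ε : ℝ), 0 < b → 0 < ε →
        ∃ C lam₀ : ℝ, 0 < lam₀ ∧
          ∀ lam : ℝ, lam ≠ 0 → |lam| < lam₀ → TCL.IsGKSL (L₀ + lam • L) →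
          ∀ ρ : ℝ → Matrix n n ℂ, TCL.IsSolution L₀ L lam ρ → ρ 0 = ρ₀ →
          ∀ t : ℝ, |lam| ^ (-ε) ≤ t → t ≤ b / lam ^ 2 →
            ‖P (ρ t) -
                (NormedSpace.exp ((lam ^ 2 * t) • K₂)
                    (TCL.renormalization L P Λ S lam ρ₀) +
                  TCL.expSubOneDiv (lam ^ 2 * t) K₂ (I₂ ((1 - P) ρ₀)))‖ ≤ C * lam ^ 2 := by
  have hom := TCL.proj_mul_exp_neg_mul (hrelax 1).1.2 (hrelax 1).2
  have hΛ : Relaxes L₀ Λ := (hrelax 1).1.1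
  obtain ⟨S, hSa, haS, hSΛ, hΛS⟩ := hΛ.exists_pseudoinverse
  have h1 := TCL.proj_mul_mul_limit_eq_zero hom hΛ hK₁ hI₁
  obtain ⟨hκL, h3⟩ := TCL.third_order_relations hom hΛ hSa haS hSΛ hΛS h1 hP
    (TCL.tendsto_tclCoeff_three_zero hom hK₃ hI₃)
  refine ⟨-(P * L * S * L * Λ) * P, -(P * L * S * L * Λ) * (1 - P), S,
    TCL.tendsto_tclCoeff_two hom hΛ hSa haS hSΛ hΛS h1 P,
    TCL.tendsto_tclCoeff_two hom hΛ hSa haS hSΛ hΛS h1 (1 - P),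
    fun X Z hLX hZ => ⟨TCL.second_order_eq hΛ hSa hSΛ h1 hLX hZ P,
      TCL.second_order_eq hΛ hSa hSΛ h1 hLX hZ (1 - P)⟩,
    ⟨hSa, by rw [sub_sub_cancel, hSΛ], by rw [sub_sub_cancel, hΛS]⟩, ?_, ?_⟩
  · rintro S' ⟨hS1, hS2, -⟩
    rw [sub_sub_cancel] at hS2
    -- `S' L₀ S` computed in two ways: `S' L₀ = 1 - Λ` and `L₀ S = 1 - Λ`.
    calc S' = S' * Λ + S' * (1 - Λ) := by rw [← mul_add, add_sub_cancel, mul_one]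
      _ = (1 - Λ) * S := by rw [hS2, zero_add, ← hS1, mul_assoc S' L₀ S, haS, hS1]
      _ = S := by rw [sub_mul, hΛS, one_mul, sub_zero]
  · intro ρ₀ b ε hb hε
    obtain ⟨c, γ, hc, hγ, hd⟩ := hΛ.exists_decay
    obtain ⟨B, hB, hGB⟩ := TCL.exists_norm_exp_le_of_isGKSL n
    obtain ⟨C, hC, hmain⟩ := exists_norm_reduced_sub_le hP hΛ hSa hSΛ hom h1
      (κ := -(P * L * S * L * Λ)) rfl (by simp only [neg_mul, hκL]) h3 hc hγ hd hb.le hB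
    -- For `t ≥ |λ|^{-ε}` the transient `|λ| e^{-γt}` is at most `(ε⁻¹ / γ) ^ ε⁻¹ λ²`; the threshold
    -- `1` is what the operator estimate requires.
    refine ⟨C * ((ε⁻¹ / γ) ^ ε⁻¹ + 1) * ‖ρ₀‖, 1, one_pos,
      fun lam hlam0 hlam1 hG ρ hρ hρ0 t ht htb => ?_⟩
    have hl : 0 < |lam| := abs_pos.2 hlam0
    have hl2 : 0 < lam ^ 2 := by positivity
    have ht0 : 0 ≤ t := (Real.rpow_pos_of_pos hl _).le.trans ht
    have htb' : lam ^ 2 * t ≤ b := by rwa [mul_comm, ← le_div_iff₀ hl2]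
    have hest := hmain lam hlam1.le (hGB _ hG) t ht0 htb'
    have hexp := Real.exp_neg_mul_le_of_rpow_neg_le hγ hε hl ht
    have hren : TCL.renormalization L P Λ S lam = P - lam • (P * L * S) := by
      rw [TCL.renormalization, mul_sub (L * S), mul_assoc L S Λ, hSΛ]
      simp only [mul_zero, mul_one, zero_sub, smul_neg, ← sub_eq_add_neg]
      rw [mul_sub, mul_one, mul_smul_comm, mul_assoc]
    have hQ : -(P * L * S * L * Λ) * (1 - P) * (1 - P) = -(P * L * S * L * Λ) * (1 - P) := by
      rw [mul_assoc]; congr 1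
      rw [mul_sub, sub_mul, sub_mul, hP]; simp
    have hop : P (ρ t) -
        (NormedSpace.exp ((lam ^ 2 * t) • (-(P * L * S * L * Λ) * P))
            (TCL.renormalization L P Λ S lam ρ₀) +
          TCL.expSubOneDiv (lam ^ 2 * t) (-(P * L * S * L * Λ) * P)
            ((-(P * L * S * L * Λ) * (1 - P)) ((1 - P) ρ₀))) =
        (P * NormedSpace.exp ((-t) • L₀) * NormedSpace.exp (t • (L₀ + lam • L)) -
          (NormedSpace.exp ((lam ^ 2 * t) • (-(P * L * S * L * Λ) * P)) * (P - lam • (P * L * S)) +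
            (∫ u in (0 : ℝ)..(lam ^ 2 * t),
              NormedSpace.exp (u • (-(P * L * S * L * Λ) * P))) *
              (-(P * L * S * L * Λ) * (1 - P)))) ρ₀ := by
      rw [hρ.eq_exp ht0, hρ0, hren]
      nth_rewrite 2 [← hQ]
      rfl
    rw [hop]
    refine (ContinuousLinearMap.le_opNorm _ _).trans ?_
    have : |lam| * Real.exp (-(γ * t)) ≤ (ε⁻¹ / γ) ^ ε⁻¹ * lam ^ 2 := by
      rw [← sq_abs lam, sq, mul_left_comm]
      exact mul_le_mul_of_nonneg_left hexp hl.le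
    calc _ ≤ C * ((ε⁻¹ / γ) ^ ε⁻¹ * lam ^ 2 + lam ^ 2) * ‖ρ₀‖ :=
          mul_le_mul_of_nonneg_right (hest.trans
            (mul_le_mul_of_nonneg_left (by linarith) hC)) (norm_nonneg _)
      _ = _ := by ring
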